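/- Let $d\in\mathbb N$. For $\varepsilon\in(0,1]$ let $(\varepsilon\mathbb Z)^d\subset\mathbb R^d$ be the scaled lattice, $\ell^2((\varepsilon\mathbb Z)^d)$ the space of square summable functions $(\varepsilon\mathbb Z)^d\to\mathbb C$, and $s((\varepsilon\mathbb Z)^d)$ the space of all $u:(\varepsilon\mathbb Z)^d\to\mathbb C$ with $\sup_{x}|x^\alpha u(x)|<\infty$ for every $\alpha\in\mathbb N^d$. Let $\mathbb T^d=\mathbb R^d/2\pi\mathbb Z^d$; functions on $\mathbb T^d$ are identified with $2\pi$-periodic functions on $\mathbb R^d$. For $r,\delta\in\mathbb R$ let $S^r_\delta(1)(\mathbb R^d\times\mathbb T^d)$ be the set of functions $a(x,\xi;\varepsilon)$ on $\mathbb R^d\times\mathbb T^d\times(0,1]$ with values in $\mathbb C$, smooth in $(x,\xi)$ for each $\varepsilon$, such that for all $\alpha,\beta\in\mathbb N^d$ there is a constant $C_{\alpha,\beta}$ with $$|\partial_x^\alpha\partial_\xi^\beta a(x,\xi;\varepsilon)|\le C_{\alpha,\beta}\,\varepsilon^{r-\delta(|\alpha|+|\beta|)}\qquad\text{for all }\varepsilon\in(0,1],\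 (x,\xi)\in\mathbb R^d\times\mathbb T^d;$$ the best (smallest) such constant is the Fréchet seminorm $\|a\|_{\alpha,\beta}$. For $u\in s((\varepsilon\mathbb Z)^d)$ put $$\mathrm{Op}_\varepsilon^{\mathbb T}(a)u(x)=(2\pi)^{-d}\sum_{y\in(\varepsilon\mathbb Z)^d}\int_{[-\pi,\pi]^d}e^{\frac i\varepsilon (y-x)\cdot\xi}\,a(x,\xi;\varepsilon)\,u(y)\,d\xi .$$ **Proposition (discrete Calderón–Vaillancourt).** There are a finite set $F\subset\mathbb N^d\times\mathbb N^d$ and a constant $K>0$, both depending only on $d$, such that the following holds for all $r\in\mathbb R$, $0\le\delta\le\frac12$, $a\in S^r_\delta(1)(\mathbb R^d\times\mathbb T^d)$, every $M>0$ with $$M\ \ge\ K\sum_{(\alpha,\beta)\in F}\|a\|_{\alpha,\beta},$$ and every $\varepsilon\in(0,1]$. For all $u\in s((\varepsilon\mathbb Z)^d)$ we have $u\in\ell^2((\varepsilon\mathbb Z)^d)$, the series defining $\mathrm{Op}_\varepsilon^{\mathbb T}(a)u(x)$ converges absolutely for every $x\in(\varepsilon\mathbb Z)^d$, $\mathrm{Op}_\varepsilon^{\mathbb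 T}(a)u\in\ell^2((\varepsilon\mathbb Z)^d)$, and $$\|\mathrm{Op}_\varepsilon^{\mathbb T}(a)u\|_{\ell^2((\varepsilon\mathbb Z)^d)}\le M\varepsilon^r\|u\|_{\ell^2((\varepsilon\mathbb Z)^d)} .$$ Moreover $\mathrm{Op}_\varepsilon^{\mathbb T}(a)$ extends from $s((\varepsilon\mathbb Z)^d)$ to a bounded linear operator on $\ell^2((\varepsilon\mathbb Z)^d)$ of operator norm at most $M\varepsilon^r$. In particular a constant $M>0$ as above exists for every $a$, it is independent of $\varepsilon$, and it can be chosen depending only on finitely many Fréchet seminorms of $a$. -/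

import Mathlib

open scoped ContDiff

noncomputable section

namespace LatticePsdo

/-- The scaled lattice `(εℤ)^d`, as a subset of `ℝ^d`. -/
def scaledLattice (d : ℕ) (ε : ℝ) : Set (Fin d → ℝ) :=
  Set.range fun (n : Fin d → ℤ) (i : Fin d) => ε * (n i : ℝ)

/-- The Hilbert space `ℓ²((εℤ)^d)` of square summable complex functions on the lattice. -/
abbrev ellTwo (d : ℕ) (ε : ℝ) : Type :=
  lp (fun _ : scaledLattice d ε => ℂ) 2

/-- Membership in the space `s((εℤ)^d)` of rapidly decreasing functions on the lattice:
`sup_x |x^α u(x)| < ∞` for every multi-index `α`. -/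
def IsRapidlyDecreasing {d : ℕ} {ε : ℝ} (u : scaledLattice d ε → ℂ) : Prop :=
  ∀ α : Fin d → ℕ, BddAbove (Set.range fun x : scaledLattice d ε =>
    ‖((∏ i, (x : Fin d → ℝ) i ^ α i : ℝ) : ℂ) * u x‖)

/-- The derivative of a function on `ℝ^d × ℝ^d` in the direction `v`. -/
def dirDeriv {d : ℕ} (v : (Fin d → ℝ) × (Fin d → ℝ))
    (f : (Fin d → ℝ) × (Fin d → ℝ) → ℂ) : (Fin d → ℝ) × (Fin d → ℝ) → ℂ :=
  fun p => fderiv ℝ f p v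

/-- The mixed partial derivative `∂_x^α ∂_ξ^β f` of a function `f` of `(x, ξ) ∈ ℝ^d × ℝ^d`. -/
def mixedPartial {d : ℕ} (α β : Fin d → ℕ) (f : (Fin d → ℝ) × (Fin d → ℝ) → ℂ) :
    (Fin d → ℝ) × (Fin d → ℝ) → ℂ :=
  (List.finRange d).foldr (fun i g => (dirDeriv (Pi.single i 1, 0))^[α i] g)
    ((List.finRange d).foldr (fun i g => (dirDeriv (0, Pi.single i 1))^[β i] g) f)

/-- `C` is an admissible constant in the symbol estimate of index `(α, β)`:
`|∂_x^α ∂_ξ^β a(x, ξ; ε)| ≤ C m(x, ξ) ε^{k - δ(|α| + |β|)}` for all `ε ∈ (0, 1]`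
and all `x, ξ`. -/
def SymbolBound {d : ℕ} (k δ : ℝ) (m : (Fin d → ℝ) → (Fin d → ℝ) → ℝ)
    (a : (Fin d → ℝ) → (Fin d → ℝ) → ℝ → ℂ) (α β : Fin d → ℕ) (C : ℝ) : Prop :=
  ∀ ε : ℝ, 0 < ε → ε ≤ 1 → ∀ x ξ : Fin d → ℝ,
    ‖mixedPartial α β (fun p => a p.1 p.2 ε) (x, ξ)‖ ≤
      C * m x ξ * ε ^ (k - δ * (((∑ i, α i) + ∑ i, β i : ℕ) : ℝ))

/-- The symbol class `S^k_δ(m)(ℝ^d × 𝕋^d)`. Functions on the torus `𝕋^d = ℝ^d / 2πℤ^d` are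
identified with `2π`-periodic functions on `ℝ^d`; only the values at `ε ∈ (0, 1]` matter. -/
structure IsSymbol {d : ℕ} (k δ : ℝ) (m : (Fin d → ℝ) → (Fin d → ℝ) → ℝ)
    (a : (Fin d → ℝ) → (Fin d → ℝ) → ℝ → ℂ) : Prop where
  smooth : ∀ ε : ℝ, 0 < ε → ε ≤ 1 →
    ContDiff ℝ ∞ (fun p : (Fin d → ℝ) × (Fin d → ℝ) => a p.1 p.2 ε)
  periodic : ∀ ε : ℝ, 0 < ε → ε ≤ 1 → ∀ (x ξ : Fin d → ℝ) (n : Fin d → ℤ),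
    a x (fun i => ξ i + 2 * Real.pi * (n i : ℝ)) ε = a x ξ ε
  bound : ∀ α β : Fin d → ℕ, ∃ C : ℝ, 0 < C ∧ SymbolBound k δ m a α β C

/-- The Fréchet seminorm `‖a‖_{α,β}`: the best constant in the symbol estimate. -/
def symbolSeminorm {d : ℕ} (k δ : ℝ) (m : (Fin d → ℝ) → (Fin d → ℝ) → ℝ)
    (a : (Fin d → ℝ) → (Fin d → ℝ) → ℝ → ℂ) (α β : Fin d → ℕ) : ℝ :=
  sInf {C : ℝ | 0 ≤ C ∧ SymbolBound k δ m a α β C}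

/-- The `y`-th term
`∫_{[-π,π]^d} e^{(i/ε)(y-x)·ξ} a(x, ξ; ε) v(y) dξ` of the series defining the operator. -/
def opTerm {d : ℕ} (a : (Fin d → ℝ) → (Fin d → ℝ) → ℝ → ℂ) (ε : ℝ)
    (v : scaledLattice d ε → ℂ) (x y : scaledLattice d ε) : ℂ :=
  ∫ ξ in Set.Icc (fun _ : Fin d => -Real.pi) (fun _ : Fin d => Real.pi),
    Complex.exp (Complex.I / (ε : ℂ) *
      ((∑ i, ((y : Fin d → ℝ) i - (x : Fin d → ℝ) i) * ξ i : ℝ) : ℂ)) * a x ξ ε * v y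

/-- The lattice pseudo-differential operator
`Op_ε(a) v (x) = (2π)^{-d} ∑_{y ∈ (εℤ)^d} ∫_{[-π,π]^d} e^{(i/ε)(y-x)·ξ} a(x, ξ; ε) v(y) dξ`. -/
def latticeOp {d : ℕ} (a : (Fin d → ℝ) → (Fin d → ℝ) → ℝ → ℂ) (ε : ℝ)
    (v : scaledLattice d ε → ℂ) : scaledLattice d ε → ℂ :=
  fun x => ((2 * (Real.pi : ℂ)) ^ d)⁻¹ * ∑' y : scaledLattice d ε, opTerm a ε v x y

end LatticePsdo

end

open LatticePsdo

namespace LatticePsdo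

/-! In units of lattice steps the operator has matrix entries `(2π)^{-d} ∫ e^{i(n-m)·ξ} a(εm, ξ; ε)
dξ`. Were the symbol independent of `x`, Parseval would bound the operator by the supremum of the
symbol. The task is therefore to detach the row index `m` from the symbol at the cost of finitely
many derivatives.

The right scale is `N = ⌈ε^{-1/2}⌉`. Since `δ ≤ 1/2`, up to constants and the factor `ε^r`, a
lattice difference in `x` gains `ε^{1-δ} ≤ ε^{1/2} ~ 1/N`, while a `ξ`-derivative loses at most `N`.

Averaging over a cell of side `N` writes `a(εm, ·)` as a sum over `σ ∈ {0,1}^d` and `p ∈ m -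
[0,N)^d` of weights in `m - p` times differences of `a` at `εp`
(`eq_sum_cellWeight_mul_latticeDiff`). Then one multiplies and divides by `∏ (1 + i(n_j - p_j)/N)`.
As `n - p = (m - p) + (n - m)` and factors `n - m` become `ξ`-derivatives, the resulting
coefficients depend on `m - p` only (`phaseWeight_mul_integral`).

For fixed `p` the double sum over `m, n` is now `∫ V U H`, with trigonometric polynomials `V`, `U`
carrying the two sequences and `H` a bounded function (`norm_sum_weighted_integral_le`). AM-GM and
Parseval bound it. In the sum over `p` all powers of `N` cancel, so `norm_bilinear_le` is uniform in
`ε` and uses only indices in `{0,1}^d`. The bound on finite sequences passes to `ℓ²` through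
`IsBoundedForm`. -/

open MeasureTheory

/-! ### Fourier analysis on the torus box. -/

/-- The fundamental domain `[-π, π]^d` of the torus. -/
def torusBox (d : ℕ) : Set (Fin d → ℝ) :=
  Set.Icc (fun _ => -Real.pi) (fun _ => Real.pi)

/-- The character `ξ ↦ e^{i k·ξ}` of the torus. -/
noncomputable def torusChar {d : ℕ} (k : Fin d → ℤ) (ξ : Fin d → ℝ) : ℂ :=
  Complex.exp (Complex.I * ((∑ i, (k i : ℝ) * ξ i : ℝ) : ℂ))

theorem isCompact_torusBox (d : ℕ) : IsCompact (torusBox d) := isCompact_Icc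

theorem integrableOn_torusBox {d : ℕ} {f : (Fin d → ℝ) → ℂ} (hf : Continuous f) :
    IntegrableOn f (torusBox d) :=
  hf.continuousOn.integrableOn_compact (isCompact_torusBox d)

theorem torusChar_add {d : ℕ} (k l : Fin d → ℤ) (ξ : Fin d → ℝ) :
    torusChar (k + l) ξ = torusChar k ξ * torusChar l ξ := by
  simp only [torusChar, ← Complex.exp_add]
  congr 1
  push_cast [Pi.add_apply]
  simp only [add_mul, Finset.sum_add_distrib, mul_add]

theorem torusChar_eq_prod {d : ℕ} (k : Fin d → ℤ) (ξ : Fin d → ℝ) :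
    torusChar k ξ = ∏ i, Complex.exp (Complex.I * (k i * ξ i)) := by
  rw [torusChar, ← Complex.exp_sum]
  congr 1
  push_cast
  rw [Finset.mul_sum]

theorem conj_torusChar {d : ℕ} (k : Fin d → ℤ) (ξ : Fin d → ℝ) :
    (starRingEnd ℂ) (torusChar k ξ) = torusChar (-k) ξ := by
  rw [torusChar, torusChar, ← Complex.exp_conj]
  congr 1
  simp

theorem contDiff_torusChar {d : ℕ} (k : Fin d → ℤ) : ContDiff ℝ ∞ (torusChar k) := by
  have h : ContDiff ℝ ∞ fun ξ : Fin d → ℝ => ∑ i, (k i : ℝ) * ξ i := by fun_prop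
  exact (contDiff_const.mul (Complex.ofRealCLM.contDiff.comp h)).cexp

theorem torusChar_periodic {d : ℕ} (k : Fin d → ℤ) (ξ : Fin d → ℝ) (n : Fin d → ℤ) :
    torusChar k (fun i => ξ i + 2 * Real.pi * (n i : ℝ)) = torusChar k ξ := by
  rw [torusChar_eq_prod, torusChar_eq_prod]
  refine Finset.prod_congr rfl fun i _ => ?_
  rw [Complex.exp_eq_exp_iff_exists_int]
  exact ⟨k i * n i, by push_cast; ring⟩

theorem fderiv_torusChar {d : ℕ} (k : Fin d → ℤ) (ξ : Fin d → ℝ) (i : Fin d) :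
    fderiv ℝ (torusChar k) ξ (Pi.single i 1) = Complex.I * k i * torusChar k ξ := by
  have h1 : HasFDerivAt (fun ξ : Fin d → ℝ => ∑ j, (k j : ℝ) * ξ j)
      (∑ j, (k j : ℝ) • (ContinuousLinearMap.proj j : (Fin d → ℝ) →L[ℝ] ℝ)) ξ :=
    HasFDerivAt.fun_sum fun j _ => (hasFDerivAt_apply j ξ).const_mul _
  have h2 := ((Complex.ofRealCLM.hasFDerivAt.comp ξ h1).const_mul Complex.I).cexp
  have h3 : HasFDerivAt (torusChar k) _ ξ := h2
  rw [h3.fderiv]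
  simp [torusChar, Pi.single_apply]
  ring

theorem integral_exp_int_mul (k : ℤ) :
    ∫ t in Set.Icc (-Real.pi) Real.pi, Complex.exp (Complex.I * (k * t)) =
      if k = 0 then ((2 * Real.pi : ℝ) : ℂ) else 0 := by
  rw [integral_Icc_eq_integral_Ioc, ← intervalIntegral.integral_of_le (by linarith [Real.pi_pos])]
  split_ifs with hk
  · subst hk
    simp
    ring
  · have hc : Complex.I * (k : ℂ) ≠ 0 := by simp [hk]
    have := integral_exp_mul_complex (a := -Real.pi) (b := Real.pi) hc
    simp only [mul_assoc] at this ⊢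
    rw [this, div_eq_zero_iff]
    left
    rw [sub_eq_zero, Complex.exp_eq_exp_iff_exists_int]
    exact ⟨k, by push_cast; ring⟩

theorem integral_torusChar {d : ℕ} (k : Fin d → ℤ) :
    ∫ ξ in torusBox d, torusChar k ξ = if k = 0 then (((2 * Real.pi) ^ d : ℝ) : ℂ) else 0 := by
  simp only [torusChar_eq_prod]
  rw [torusBox, ← Set.pi_univ_Icc, volume_pi, Measure.restrict_pi_pi,
    integral_fintype_prod_eq_prod (fun i (t : ℝ) => Complex.exp (Complex.I * (k i * t)))]
  simp only [integral_exp_int_mul]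
  split_ifs with hk
  · simp [hk]
  · obtain ⟨i, hi⟩ := Function.ne_iff.mp hk
    exact Finset.prod_eq_zero (Finset.mem_univ i) (if_neg hi)

/-- Parseval's identity for trigonometric polynomials. -/
theorem integral_norm_sq_trigPoly {d : ℕ} (A : Finset (Fin d → ℤ)) (c : (Fin d → ℤ) → ℂ) :
    ∫ ξ in torusBox d, ‖∑ n ∈ A, c n * torusChar n ξ‖ ^ 2 =
      (2 * Real.pi) ^ d * ∑ n ∈ A, ‖c n‖ ^ 2 := by
  have h : ∀ ξ : Fin d → ℝ, ((‖∑ n ∈ A, c n * torusChar n ξ‖ ^ 2 : ℝ) : ℂ) =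
      ∑ n ∈ A, ∑ m ∈ A, c n * (starRingEnd ℂ) (c m) * torusChar (n - m) ξ := by
    intro ξ
    rw [Complex.ofReal_pow, ← Complex.mul_conj', map_sum, Finset.sum_mul_sum]
    refine Finset.sum_congr rfl fun n _ => Finset.sum_congr rfl fun m _ => ?_
    rw [map_mul, conj_torusChar, sub_eq_add_neg, torusChar_add]
    ring
  rw [← Complex.ofReal_inj, ← integral_complex_ofReal]
  simp only [h]
  have hint : ∀ n m, IntegrableOn
      (fun ξ => c n * (starRingEnd ℂ) (c m) * torusChar (n - m) ξ) (torusBox d) := fun n m =>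
    integrableOn_torusBox (continuous_const.mul (contDiff_torusChar _).continuous)
  rw [integral_finsetSum _ fun n _ => integrable_finsetSum _ fun m _ => hint n m]
  push_cast
  rw [Finset.mul_sum]
  refine Finset.sum_congr rfl fun n hn => ?_
  rw [integral_finsetSum _ fun m _ => hint n m, Finset.sum_eq_single n]
  · rw [integral_const_mul, integral_torusChar, if_pos (sub_self n), ← Complex.mul_conj']
    push_cast
    ring
  · intro m _ hm
    rw [integral_const_mul, integral_torusChar, if_neg (sub_ne_zero.mpr hm.symm), mul_zero]
  · exact fun h => absurd hn h

/-- The partial derivative of a periodic function has mean value zero. -/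
theorem integral_partial_eq_zero {d : ℕ} {F : (Fin d → ℝ) → ℂ} (hF : ContDiff ℝ ∞ F)
    (hper : ∀ (ξ : Fin d → ℝ) (n : Fin d → ℤ),
      F (fun i => ξ i + 2 * Real.pi * (n i : ℝ)) = F ξ) (i : Fin d) :
    ∫ ξ in torusBox d, fderiv ℝ F ξ (Pi.single i 1) = 0 := by
  cases d with
  | zero => exact i.elim0
  | succ d =>
    have hle : (fun _ : Fin (d + 1) => -Real.pi) ≤ fun _ => Real.pi :=
      fun _ => by linarith [Real.pi_pos]
    have hcont : Continuous fun ξ => fderiv ℝ F ξ (Pi.single i 1) :=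
      (hF.continuous_fderiv (by simp)).clm_apply continuous_const
    have hdiff : ∀ ξ, HasFDerivAt F (fderiv ℝ F ξ) ξ := fun ξ =>
      (hF.differentiable (by simp) ξ).hasFDerivAt
    have hsum : ∀ ξ, ∑ j, (if j = i then fderiv ℝ F ξ else 0) (Pi.single j 1) =
        fderiv ℝ F ξ (Pi.single i 1) := by
      intro ξ
      rw [Finset.sum_eq_single i] <;> simp +contextual
    -- Divergence theorem for the vector field whose only nonzero component is `F`, in direction
    -- `i`.
    have key := integral_divergence_of_hasFDerivAt_off_countable' (E := ℂ)
      (fun _ : Fin (d + 1) => -Real.pi) (fun _ => Real.pi) hle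
      (fun j ξ => if j = i then F ξ else 0) (fun j ξ => if j = i then fderiv ℝ F ξ else 0)
      ∅ Set.countable_empty
      (fun j => by
        by_cases h : j = i
        · simpa [h] using hF.continuous.continuousOn
        · simpa [h] using continuousOn_const)
      (fun ξ _ j => by
        by_cases h : j = i
        · simpa [h] using hdiff ξ
        · simpa [h] using hasFDerivAt_const (0 : ℂ) ξ)
      (by simp only [hsum]; exact integrableOn_torusBox hcont)
    simp only [hsum] at key
    rw [torusBox, key]
    refine Finset.sum_eq_zero fun j _ => ?_
    by_cases h : j = i
    · subst h
      simp only [if_true]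
      rw [sub_eq_zero]
      congr 1
      ext y
      -- The two faces orthogonal to `j` differ by one period, so their contributions cancel.
      rw [← hper (j.insertNth (-Real.pi) y) (Pi.single j 1)]
      congr 1
      ext l
      refine Fin.succAboveCases j ?_ (fun l => ?_) l
      · simp
        ring
      · simp
    · simp [h]

/-! ### Smooth functions periodic in frequency, and their iterated derivatives. -/

/-- Smooth functions on `ℝ^d × 𝕋^d`, viewed as functions on `ℝ^d × ℝ^d`. -/
structure IsTorusSmooth {d : ℕ} (F : (Fin d → ℝ) × (Fin d → ℝ) → ℂ) : Prop where
  contDiff : ContDiff ℝ ∞ F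
  periodic : ∀ (x ξ : Fin d → ℝ) (n : Fin d → ℤ),
    F (x, fun i => ξ i + 2 * Real.pi * (n i : ℝ)) = F (x, ξ)

/-- The iterated derivatives of `F`, taken `γ i` times along `e i` for each `i` in a list. -/
noncomputable def listDeriv {d : ℕ} (e : Fin d → (Fin d → ℝ) × (Fin d → ℝ)) (γ : Fin d → ℕ) (l : List (Fin d))
    (F : (Fin d → ℝ) × (Fin d → ℝ) → ℂ) : (Fin d → ℝ) × (Fin d → ℝ) → ℂ :=
  l.foldr (fun i g => (dirDeriv (e i))^[γ i] g) F

section Closure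

variable {d : ℕ} {F : (Fin d → ℝ) × (Fin d → ℝ) → ℂ}

theorem IsTorusSmooth.comp_sub (hF : IsTorusSmooth F) (s : Fin d → ℝ) :
    IsTorusSmooth fun p => F (p - (s, 0)) where
  contDiff := hF.contDiff.comp (contDiff_id.sub contDiff_const)
  periodic x ξ n := by simpa using hF.periodic (x - s) ξ n

theorem IsTorusSmooth.dirDeriv (hF : IsTorusSmooth F) (v : (Fin d → ℝ) × (Fin d → ℝ)) :
    IsTorusSmooth (dirDeriv v F) where
  contDiff := (hF.contDiff.fderiv_right (m := ∞) (by simp)).clm_apply contDiff_const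
  periodic x ξ n := by
    have h : (fun p => F (p + (0, fun i => 2 * Real.pi * (n i : ℝ)))) = F := by
      ext ⟨x, ξ⟩
      simpa [Pi.add_def] using hF.periodic x ξ n
    have h2 := fderiv_comp_add_right (𝕜 := ℝ) (f := F) (x := (x, ξ))
      (0, fun i => 2 * Real.pi * (n i : ℝ))
    rw [h] at h2
    simp only [LatticePsdo.dirDeriv]
    rw [h2]
    simp [Pi.add_def]

theorem IsTorusSmooth.dirDeriv_iterate (hF : IsTorusSmooth F)
    (v : (Fin d → ℝ) × (Fin d → ℝ)) (k : ℕ) :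
    IsTorusSmooth ((LatticePsdo.dirDeriv v)^[k] F) := by
  induction k with
  | zero => exact hF
  | succ k ih => rw [Function.iterate_succ_apply']; exact ih.dirDeriv v

theorem IsTorusSmooth.listDeriv (hF : IsTorusSmooth F)
    (e : Fin d → (Fin d → ℝ) × (Fin d → ℝ)) (γ : Fin d → ℕ) (l : List (Fin d)) :
    IsTorusSmooth (listDeriv e γ l F) := by
  induction l with
  | nil => exact hF
  | cons i l ih => exact ih.dirDeriv_iterate _ _

theorem IsTorusSmooth.const_mul (hF : IsTorusSmooth F) (c : ℂ) :
    IsTorusSmooth fun p => c * F p where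
  contDiff := contDiff_const.mul hF.contDiff
  periodic x ξ n := by rw [hF.periodic]

theorem IsTorusSmooth.hasFDerivAt (hF : IsTorusSmooth F) (p : (Fin d → ℝ) × (Fin d → ℝ)) :
    HasFDerivAt F (fderiv ℝ F p) p :=
  (hF.contDiff.differentiable (by simp) p).hasFDerivAt

theorem IsTorusSmooth.continuous_snd (hF : IsTorusSmooth F) (x : Fin d → ℝ) :
    Continuous fun ξ => F (x, ξ) :=
  hF.contDiff.continuous.comp (Continuous.prodMk_right x)

end Closure

/-! ### Integration by parts in frequency. -/

section IntegrationByParts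

variable {d : ℕ} {F : (Fin d → ℝ) × (Fin d → ℝ) → ℂ}

theorem integral_torusChar_mul_dirDeriv (hF : IsTorusSmooth F) (k : Fin d → ℤ)
    (x : Fin d → ℝ) (i : Fin d) :
    ∫ ξ in torusBox d, torusChar k ξ * dirDeriv (0, Pi.single i 1) F (x, ξ) =
      -(Complex.I * k i) * ∫ ξ in torusBox d, torusChar k ξ * F (x, ξ) := by
  have hχ := contDiff_torusChar k
  have hslice : ∀ ξ, HasFDerivAt (fun ξ => F (x, ξ))
      ((fderiv ℝ F (x, ξ)).comp (ContinuousLinearMap.inr ℝ (Fin d → ℝ) (Fin d → ℝ))) ξ :=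
    fun ξ => (hF.hasFDerivAt (x, ξ)).comp ξ (hasFDerivAt_prodMk_right x ξ)
  have hsmooth : ContDiff ℝ ∞ fun ξ => torusChar k ξ * F (x, ξ) :=
    hχ.mul (hF.contDiff.comp (contDiff_const.prodMk contDiff_id))
  have hder : ∀ ξ, fderiv ℝ (fun ξ => torusChar k ξ * F (x, ξ)) ξ (Pi.single i 1) =
      torusChar k ξ * dirDeriv (0, Pi.single i 1) F (x, ξ) +
        Complex.I * k i * (torusChar k ξ * F (x, ξ)) := by
    intro ξ
    have := ((hχ.differentiable (by simp) ξ).hasFDerivAt).mul (hslice ξ)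
    have h' : HasFDerivAt (fun ξ => torusChar k ξ * F (x, ξ)) _ ξ := this
    rw [h'.fderiv]
    simp [fderiv_torusChar, dirDeriv]
    ring
  have hzero := integral_partial_eq_zero hsmooth
    (fun ξ n => by rw [torusChar_periodic, hF.periodic]) i
  simp only [hder] at hzero
  rw [integral_add, integral_const_mul] at hzero
  · linear_combination hzero
  · exact integrableOn_torusBox (hχ.continuous.mul ((hF.dirDeriv _).continuous_snd x))
  · exact integrableOn_torusBox
      (continuous_const.mul (hχ.continuous.mul (hF.continuous_snd x)))

theorem integral_torusChar_mul_dirDeriv_iterate (hF : IsTorusSmooth F) (k : Fin d → ℤ)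
    (x : Fin d → ℝ) (i : Fin d) (j : ℕ) :
    ∫ ξ in torusBox d, torusChar k ξ * (dirDeriv (0, Pi.single i 1))^[j] F (x, ξ) =
      (-(Complex.I * k i)) ^ j * ∫ ξ in torusBox d, torusChar k ξ * F (x, ξ) := by
  induction j with
  | zero => simp
  | succ j ih =>
    simp only [Function.iterate_succ_apply']
    rw [integral_torusChar_mul_dirDeriv (hF.dirDeriv_iterate _ j), ih]
    ring

theorem integral_torusChar_mul_listDeriv (hF : IsTorusSmooth F) (k : Fin d → ℤ)
    (x : Fin d → ℝ) (γ : Fin d → ℕ) (l : List (Fin d)) :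
    ∫ ξ in torusBox d, torusChar k ξ * listDeriv (fun i => (0, Pi.single i 1)) γ l F (x, ξ) =
      (l.map fun i => (-(Complex.I * k i)) ^ γ i).prod *
        ∫ ξ in torusBox d, torusChar k ξ * F (x, ξ) := by
  induction l with
  | nil => simp [listDeriv]
  | cons i l ih =>
    rw [List.map_cons, List.prod_cons, mul_assoc, ← ih]
    exact integral_torusChar_mul_dirDeriv_iterate (hF.listDeriv _ γ l) k x i (γ i)

/-- The derivative `∂_ξ^γ F`. -/
noncomputable def freqDeriv {d : ℕ} (γ : Fin d → ℕ) (F : (Fin d → ℝ) × (Fin d → ℝ) → ℂ) :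
    (Fin d → ℝ) × (Fin d → ℝ) → ℂ :=
  listDeriv (fun i => (0, Pi.single i 1)) γ (List.finRange d) F

theorem integral_torusChar_mul_freqDeriv (hF : IsTorusSmooth F) (k : Fin d → ℤ)
    (x : Fin d → ℝ) (γ : Fin d → ℕ) :
    ∫ ξ in torusBox d, torusChar k ξ * freqDeriv γ F (x, ξ) =
      (∏ i, (-(Complex.I * k i)) ^ γ i) * ∫ ξ in torusBox d, torusChar k ξ * F (x, ξ) := by
  rw [freqDeriv, integral_torusChar_mul_listDeriv hF, Fin.prod_univ_def]

/-- The multi-indices with entries in `{0, 1}`. -/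
def cubeIndices (d : ℕ) : Finset (Fin d → ℕ) := Fintype.piFinset fun _ => Finset.range 2

/-- The weight `∏ (1 + i k_j / N)`. -/
noncomputable def phaseWeight {d : ℕ} (N : ℕ) (k : Fin d → ℤ) : ℂ :=
  ∏ i, (1 + Complex.I * k i / N)

/-- The coefficient of `∂_ξ^τ` after integration by parts against `phaseWeight`. -/
noncomputable def phaseCoeff {d : ℕ} (N : ℕ) (τ : Fin d → ℕ) (k : Fin d → ℤ) : ℂ :=
  ∏ i, ((1 + Complex.I * k i / N) ^ (1 - τ i) * (-1 / N) ^ τ i)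

/-- In each coordinate `1 + i(n-p)/N = (1 + i(m-p)/N) + (-1/N)(-i(n-m))`. Expanding the product, `τ`
records the coordinates where the second summand is taken; there `-i(n-m)` is the effect of `∂_ξ`
under the integral. The column index `n` thus survives only in the character. -/
theorem phaseWeight_mul_integral (hF : IsTorusSmooth F) (N : ℕ) (m n p : Fin d → ℤ)
    (x : Fin d → ℝ) :
    phaseWeight N (n - p) * ∫ ξ in torusBox d, torusChar (n - m) ξ * F (x, ξ) =
      ∑ τ ∈ cubeIndices d, phaseCoeff N τ (m - p) *
        ∫ ξ in torusBox d, torusChar (n - m) ξ * freqDeriv τ F (x, ξ) := by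
  have h : phaseWeight N (n - p) = ∏ i, ∑ j ∈ Finset.range 2,
      (1 + Complex.I * (m - p) i / N) ^ (1 - j) * (-1 / N) ^ j *
        (-(Complex.I * (n - m) i)) ^ j := by
    refine Finset.prod_congr rfl fun i _ => ?_
    simp [Finset.sum_range_succ]
    ring
  rw [h, Finset.prod_univ_sum, Finset.sum_mul]
  refine Finset.sum_congr rfl fun τ _ => ?_
  rw [integral_torusChar_mul_freqDeriv hF, Finset.prod_mul_distrib, phaseCoeff, mul_assoc]

end IntegrationByParts

/-! ### Lattice translations as a group algebra action, and estimates of differences. -/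

/-- Translations in `x` along the scaled lattice, acting on functions of `(x, ξ)`. -/
def shiftHom (d : ℕ) (ε : ℝ) : Multiplicative (Fin d → ℤ) →*
    Module.End ℂ ((Fin d → ℝ) × (Fin d → ℝ) → ℂ) where
  toFun s :=
    { toFun := fun F p => F (p - (fun i => ε * (s.toAdd i : ℝ), 0))
      map_add' := fun _ _ => rfl
      map_smul' := fun _ _ => rfl }
  map_one' := by
    ext F p
    simp only [toAdd_one, Pi.zero_apply, Int.cast_zero, mul_zero, LinearMap.coe_mk, AddHom.coe_mk,
      Module.End.one_apply]
    congr 1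
    exact sub_zero p
  map_mul' s t := by
    ext F p
    simp only [toAdd_mul, Pi.add_apply, Int.cast_add, LinearMap.coe_mk, AddHom.coe_mk,
      Module.End.mul_apply]
    congr 1
    ext i <;> simp
    ring

/-- The action of the group algebra of `ℤ^d` by translations in `x` along the scaled lattice. -/
noncomputable def shiftAction (d : ℕ) (ε : ℝ) : AddMonoidAlgebra ℂ (Fin d → ℤ) →ₐ[ℂ]
    Module.End ℂ ((Fin d → ℝ) × (Fin d → ℝ) → ℂ) :=
  AddMonoidAlgebra.lift ℂ _ _ (shiftHom d ε)

/-- The translation by one lattice step in direction `i`. -/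
noncomputable def shiftVar {d : ℕ} (i : Fin d) : AddMonoidAlgebra ℂ (Fin d → ℤ) :=
  AddMonoidAlgebra.of ℂ _ (Multiplicative.ofAdd (Pi.single i 1))

section Shift

variable {d : ℕ} {ε : ℝ} {F : (Fin d → ℝ) × (Fin d → ℝ) → ℂ}

theorem shiftAction_single (s : Fin d → ℤ) (c : ℂ) (p : (Fin d → ℝ) × (Fin d → ℝ)) :
    shiftAction d ε (AddMonoidAlgebra.single s c) F p =
      c * F (p - (fun i => ε * (s i : ℝ), 0)) := by
  rw [shiftAction, AddMonoidAlgebra.lift_single]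
  rfl

theorem shiftAction_shiftVar (i : Fin d) (p : (Fin d → ℝ) × (Fin d → ℝ)) :
    shiftAction d ε (shiftVar i) F p = F (p - ε • (Pi.single i 1, 0)) := by
  rw [shiftVar, AddMonoidAlgebra.of_apply, shiftAction_single, one_mul]
  congr 2
  ext j <;> simp [Pi.single_apply]

theorem shiftAction_prod_shiftVar_pow (n : Fin d → ℕ) (p : (Fin d → ℝ) × (Fin d → ℝ)) :
    shiftAction d ε (∏ i, shiftVar i ^ n i) F p = F (p - (fun i => ε * (n i : ℝ), 0)) := by
  have h : ∏ i, (Multiplicative.ofAdd (Pi.single i 1 : Fin d → ℤ)) ^ n i =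
      Multiplicative.ofAdd fun i => (n i : ℤ) := by
    apply Multiplicative.toAdd.injective
    ext j
    simp [toAdd_prod, Finset.sum_apply, Pi.single_apply]
  simp only [shiftVar, ← map_pow, ← map_prod]
  rw [h, AddMonoidAlgebra.of_apply, shiftAction_single, one_mul]
  simp

/-- Both claims are proved in one induction because differentiating a sum needs the
differentiability of its summands. -/
theorem IsTorusSmooth.shiftAction_and_dirDeriv (hF : IsTorusSmooth F)
    (q : AddMonoidAlgebra ℂ (Fin d → ℤ)) (v : (Fin d → ℝ) × (Fin d → ℝ)) :
    IsTorusSmooth (shiftAction d ε q F) ∧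
      LatticePsdo.dirDeriv v (shiftAction d ε q F) =
        shiftAction d ε q (LatticePsdo.dirDeriv v F) := by
  induction q using AddMonoidAlgebra.induction_linear with
  | zero =>
    simp only [map_zero, LinearMap.zero_apply]
    refine ⟨⟨contDiff_const, fun _ _ _ => rfl⟩, ?_⟩
    ext p
    simp [LatticePsdo.dirDeriv]
  | add f g hf hg =>
    simp only [map_add, LinearMap.add_apply]
    refine ⟨⟨hf.1.contDiff.add hg.1.contDiff, fun x ξ n => ?_⟩, ?_⟩
    · simp only [Pi.add_apply]
      rw [hf.1.periodic, hg.1.periodic]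
    · rw [← hf.2, ← hg.2]
      ext p
      simp only [LatticePsdo.dirDeriv, Pi.add_apply]
      rw [((hf.1.hasFDerivAt p).add (hg.1.hasFDerivAt p)).fderiv]
      rfl
  | single s c =>
    have h : ∀ G : (Fin d → ℝ) × (Fin d → ℝ) → ℂ,
        shiftAction d ε (AddMonoidAlgebra.single s c) G =
          fun p => c * G (p - (fun i => ε * (s i : ℝ), 0)) :=
      fun G => funext fun p => shiftAction_single s c p
    rw [h, h]
    refine ⟨(hF.comp_sub _).const_mul c, ?_⟩
    ext p
    have h2 : HasFDerivAt (fun p => c * F (p - (fun i => ε * (s i : ℝ), 0))) _ p :=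
      ((hF.comp_sub (fun i => ε * (s i : ℝ))).hasFDerivAt p).const_mul c
    simp only [LatticePsdo.dirDeriv]
    rw [h2.fderiv, fderiv_comp_sub]
    rfl

theorem IsTorusSmooth.shiftAction (hF : IsTorusSmooth F)
    (q : AddMonoidAlgebra ℂ (Fin d → ℤ)) : IsTorusSmooth (shiftAction d ε q F) :=
  (hF.shiftAction_and_dirDeriv q 0).1

theorem IsTorusSmooth.dirDeriv_shiftAction (hF : IsTorusSmooth F)
    (q : AddMonoidAlgebra ℂ (Fin d → ℤ)) (v : (Fin d → ℝ) × (Fin d → ℝ)) :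
    LatticePsdo.dirDeriv v (LatticePsdo.shiftAction d ε q F) =
      LatticePsdo.shiftAction d ε q (LatticePsdo.dirDeriv v F) :=
  (hF.shiftAction_and_dirDeriv q v).2

theorem IsTorusSmooth.dirDeriv_iterate_shiftAction (hF : IsTorusSmooth F)
    (q : AddMonoidAlgebra ℂ (Fin d → ℤ)) (v : (Fin d → ℝ) × (Fin d → ℝ)) (k : ℕ) :
    (LatticePsdo.dirDeriv v)^[k] (LatticePsdo.shiftAction d ε q F) =
      LatticePsdo.shiftAction d ε q ((LatticePsdo.dirDeriv v)^[k] F) := by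
  induction k with
  | zero => rfl
  | succ k ih =>
    rw [Function.iterate_succ_apply', Function.iterate_succ_apply', ih,
      (hF.dirDeriv_iterate v k).dirDeriv_shiftAction]

theorem IsTorusSmooth.listDeriv_shiftAction (hF : IsTorusSmooth F)
    (q : AddMonoidAlgebra ℂ (Fin d → ℤ)) (e : Fin d → (Fin d → ℝ) × (Fin d → ℝ))
    (γ : Fin d → ℕ) (l : List (Fin d)) :
    LatticePsdo.listDeriv e γ l (LatticePsdo.shiftAction d ε q F) =
      LatticePsdo.shiftAction d ε q (LatticePsdo.listDeriv e γ l F) := by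
  induction l with
  | nil => rfl
  | cons i l ih =>
    change (LatticePsdo.dirDeriv (e i))^[γ i] (LatticePsdo.listDeriv e γ l _) = _
    rw [ih, (hF.listDeriv e γ l).dirDeriv_iterate_shiftAction]
    rfl

/-- Mean value estimate for a first difference. -/
theorem IsTorusSmooth.norm_sub_shift_le (hF : IsTorusSmooth F) {C : ℝ} (hε : 0 ≤ ε)
    {v : (Fin d → ℝ) × (Fin d → ℝ)} (hC : ∀ p, ‖LatticePsdo.dirDeriv v F p‖ ≤ C)
    (p : (Fin d → ℝ) × (Fin d → ℝ)) : ‖F p - F (p - ε • v)‖ ≤ ε * C := by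
  have hline : ∀ t : ℝ, HasDerivAt (fun t : ℝ => p - ε • v + t • (ε • v)) (ε • v) t := fun t => by
    simpa using ((hasDerivAt_id t).smul_const (ε • v)).const_add (p - ε • v)
  have h := norm_image_sub_le_of_norm_deriv_le_segment_01'
    (f := fun t : ℝ => F (p - ε • v + t • (ε • v)))
    (f' := fun t => fderiv ℝ F (p - ε • v + t • (ε • v)) (ε • v)) (C := ε * C)
    (fun t _ => ((hF.hasFDerivAt _).comp_hasDerivAt t (hline t)).hasDerivWithinAt)
    (fun t _ => by
      rw [map_smul, norm_smul, Real.norm_of_nonneg hε]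
      exact mul_le_mul_of_nonneg_left (hC _) hε)
  simpa using h

/-- Each factor `1 - S_i` trades one `x_i`-derivative for a factor `ε` by the mean value inequality,
as translations commute with derivatives. The spectator `q` lets the estimate be iterated over the
coordinates. -/
theorem IsTorusSmooth.norm_shiftAction_mul_pow_le (hF : IsTorusSmooth F) {C : ℝ} (hε : 0 ≤ ε)
    (q : AddMonoidAlgebra ℂ (Fin d → ℤ)) (i : Fin d) (k : ℕ)
    (hC : ∀ p, ‖LatticePsdo.shiftAction d ε q
      ((LatticePsdo.dirDeriv (Pi.single i 1, 0))^[k] F) p‖ ≤ C)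
    (p : (Fin d → ℝ) × (Fin d → ℝ)) :
    ‖LatticePsdo.shiftAction d ε (q * (1 - shiftVar i) ^ k) F p‖ ≤ ε ^ k * C := by
  induction k generalizing F C p with
  | zero => simpa using hC p
  | succ k ih =>
    have hstep : ∀ p, ‖LatticePsdo.shiftAction d ε (q * (1 - shiftVar i) ^ k)
        (LatticePsdo.dirDeriv (Pi.single i 1, 0) F) p‖ ≤ ε ^ k * C :=
      fun p => ih (hF.dirDeriv _) hC p
    have h := (hF.shiftAction (ε := ε) (q * (1 - shiftVar i) ^ k)).norm_sub_shift_le hε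
      (v := (Pi.single i 1, 0)) (by rwa [hF.dirDeriv_shiftAction]) p
    have heq : LatticePsdo.shiftAction d ε (q * (1 - shiftVar i) ^ (k + 1)) F p =
        LatticePsdo.shiftAction d ε (q * (1 - shiftVar i) ^ k) F p -
          LatticePsdo.shiftAction d ε (q * (1 - shiftVar i) ^ k) F
            (p - ε • (Pi.single i 1, 0)) := by
      rw [pow_succ, ← mul_assoc, mul_comm, map_mul, map_sub, map_one, Module.End.mul_apply,
        LinearMap.sub_apply, Module.End.one_apply, Pi.sub_apply, shiftAction_shiftVar]
    rw [heq, pow_succ', mul_assoc]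
    exact h

theorem IsTorusSmooth.norm_shiftAction_mul_prod_le (hF : IsTorusSmooth F) {C : ℝ} (hε : 0 ≤ ε)
    (q : AddMonoidAlgebra ℂ (Fin d → ℤ)) (γ : Fin d → ℕ) (l : List (Fin d))
    (hC : ∀ p, ‖LatticePsdo.shiftAction d ε q
      (LatticePsdo.listDeriv (fun i => (Pi.single i 1, 0)) γ l F) p‖ ≤ C)
    (p : (Fin d → ℝ) × (Fin d → ℝ)) :
    ‖LatticePsdo.shiftAction d ε (q * (l.map fun i => (1 - shiftVar i) ^ γ i).prod) F p‖ ≤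
      (l.map fun i => ε ^ γ i).prod * C := by
  induction l generalizing q C p with
  | nil => simpa [LatticePsdo.listDeriv] using hC p
  | cons i l ih =>
    rw [List.map_cons, List.prod_cons, List.map_cons, List.prod_cons, ← mul_assoc,
      mul_comm (ε ^ γ i), mul_assoc _ (ε ^ γ i)]
    exact ih _ (fun p => (hF.listDeriv _ γ l).norm_shiftAction_mul_pow_le hε q i (γ i) hC p) p

/-- The mixed difference operator `∏ (1 - S_i)^{σ_i}`. -/
noncomputable def latticeDiff (d : ℕ) (σ : Fin d → ℕ) : AddMonoidAlgebra ℂ (Fin d → ℤ) :=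
  ∏ i, (1 - shiftVar i) ^ σ i

theorem IsTorusSmooth.norm_latticeDiff_freqDeriv_le (hF : IsTorusSmooth F) {C : ℝ} (hε : 0 ≤ ε)
    (σ τ : Fin d → ℕ) (hC : ∀ p, ‖mixedPartial σ τ F p‖ ≤ C)
    (p : (Fin d → ℝ) × (Fin d → ℝ)) :
    ‖freqDeriv τ (LatticePsdo.shiftAction d ε (latticeDiff d σ) F) p‖ ≤
      ε ^ (∑ i, σ i) * C := by
  rw [freqDeriv, hF.listDeriv_shiftAction, latticeDiff, Fin.prod_univ_def,
    ← Finset.prod_pow_eq_pow_sum, Fin.prod_univ_def, ← one_mul (List.prod _)]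
  refine (hF.listDeriv _ τ _).norm_shiftAction_mul_prod_le hε 1 σ _ (fun p => ?_) p
  rw [map_one]
  exact hC p

end Shift

/-! ### Averaging over a cell of side `N`. -/

section Averaging

/-- The weights of the averaging identity. -/
noncomputable def avgWeight (N : ℕ) (j : ℕ) (l : ℤ) : ℂ := (N - 1 - l) ^ j / N

/-- Average `1 = x^j + (1 - x^j)` over `0 ≤ j < N` and expand `1 - x^j = ∑_{l<j} x^l (1 - x)`; the
term with index `l` occurs for `l < j < N`, hence `N - 1 - l` times. Allowing any commutative
algebra makes it applicable to the translations `shiftVar i`. -/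
theorem sum_avgWeight_smul {A : Type*} [CommRing A] [Algebra ℂ A] {N : ℕ} (hN : N ≠ 0) (x : A) :
    ∑ j ∈ Finset.range 2, ∑ l ∈ Finset.Ico (0 : ℤ) N,
      avgWeight N j l • (x ^ l.toNat * (1 - x) ^ j) = 1 := by
  have hN' : (N : ℂ) ≠ 0 := by exact_mod_cast hN
  have hcast : ∀ f : ℤ → A, ∑ l ∈ Finset.Ico (0 : ℤ) N, f l = ∑ l ∈ Finset.range N, f l := by
    intro f
    refine Finset.sum_nbij' Int.toNat Nat.cast ?_ ?_ ?_ ?_ ?_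
    · intro a ha; simp at ha ⊢; omega
    · intro a ha; simp at ha ⊢; omega
    · intro a ha; simp at ha ⊢; omega
    · intro a ha; simp
    · intro a ha; simp at ha; rw [Int.toNat_of_nonneg ha.1]
  -- The identity times `K`, with the length of the cell freed for induction.
  have htel : ∀ K : ℕ, ∑ l ∈ Finset.range K, ((K : ℂ) - 1 - l) • (x ^ l * (1 - x)) +
      ∑ l ∈ Finset.range K, x ^ l = (K : ℂ) • (1 : A) := by
    intro K
    induction K with
    | zero => simp
    | succ K ih =>
      have hstep : ∑ l ∈ Finset.range K, (((K + 1 : ℕ) : ℂ) - 1 - l) • (x ^ l * (1 - x)) =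
          ∑ l ∈ Finset.range K, ((K : ℂ) - 1 - l) • (x ^ l * (1 - x)) + (1 - x ^ K) := by
        rw [← geom_sum_mul_neg x K, Finset.sum_mul, ← Finset.sum_add_distrib]
        refine Finset.sum_congr rfl fun l _ => ?_
        push_cast
        module
      rw [Finset.sum_range_succ, Finset.sum_range_succ, hstep]
      push_cast
      rw [add_smul, ← ih]
      simp
      ring
  simp only [hcast, Finset.sum_range_succ, Finset.range_zero, Finset.sum_empty, zero_add, avgWeight,
    pow_zero, pow_one, mul_one, Int.toNat_natCast, Int.cast_natCast]
  have h := congrArg (fun a => (N : ℂ)⁻¹ • a) (htel N)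
  simp only [smul_add, Finset.smul_sum, smul_smul, inv_mul_cancel₀ hN', one_smul] at h
  rw [add_comm] at h
  refine Eq.trans ?_ h
  congr 1
  · simp only [one_div]
  · simp only [div_eq_inv_mul]

/-- The lattice points of the cell `[0, N)^d`. -/
noncomputable def latticeCell (d N : ℕ) : Finset (Fin d → ℤ) := Fintype.piFinset fun _ => Finset.Ico (0 : ℤ) N

/-- The weights of the averaging identity over the cell `[0, N)^d`. -/
noncomputable def cellWeight {d : ℕ} (N : ℕ) (σ : Fin d → ℕ) (k : Fin d → ℤ) : ℂ :=
  if k ∈ latticeCell d N then ∏ i, avgWeight N (σ i) (k i) else 0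

theorem sum_cellWeight_smul {A : Type*} [CommRing A] [Algebra ℂ A] {d N : ℕ} (hN : N ≠ 0)
    (x : Fin d → A) :
    ∑ σ ∈ cubeIndices d, ∑ l ∈ latticeCell d N,
      (∏ i, avgWeight N (σ i) (l i)) •
        ((∏ i, x i ^ (l i).toNat) * ∏ i, (1 - x i) ^ σ i) = 1 := by
  have h := Finset.prod_univ_sum (fun _ : Fin d => Finset.range 2)
    (fun i j => ∑ l ∈ Finset.Ico (0 : ℤ) N,
      avgWeight N j l • (x i ^ l.toNat * (1 - x i) ^ j))
  simp only [sum_avgWeight_smul hN, Finset.prod_const_one] at h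
  refine Eq.trans (Finset.sum_congr rfl fun σ _ => ?_) h.symm
  rw [Finset.prod_univ_sum]
  refine Finset.sum_congr rfl fun l _ => ?_
  simp only [Algebra.smul_def, Finset.prod_mul_distrib, map_prod]

/-- A function at a lattice point as a weighted sum of its differences over a cell. -/
theorem eq_sum_cellWeight_mul_latticeDiff {d N : ℕ} (hN : N ≠ 0) (ε : ℝ)
    (F : (Fin d → ℝ) × (Fin d → ℝ) → ℂ) (m : Fin d → ℤ) (P : Finset (Fin d → ℤ))
    (hP : ∀ l ∈ latticeCell d N, m - l ∈ P) (ξ : Fin d → ℝ) :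
    F (fun i => ε * (m i : ℝ), ξ) = ∑ σ ∈ cubeIndices d, ∑ p ∈ P, cellWeight N σ (m - p) *
      shiftAction d ε (latticeDiff d σ) F (fun i => ε * (p i : ℝ), ξ) := by
  have h := congrArg (fun q => shiftAction d ε q F (fun i => ε * (m i : ℝ), ξ))
    (sum_cellWeight_smul hN (shiftVar (d := d)))
  simp only [map_sum, map_smul, map_one, map_mul, LinearMap.sum_apply, Finset.sum_apply,
    LinearMap.smul_apply, Pi.smul_apply, Module.End.one_apply, Module.End.mul_apply] at h
  rw [← h]
  refine Finset.sum_congr rfl fun σ _ => ?_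
  simp only [cellWeight, ite_mul, zero_mul]
  rw [← Finset.sum_filter]
  refine Finset.sum_nbij' (fun l => m - l) (fun p => m - p) ?_ ?_ ?_ ?_ ?_
  · intro l hl
    simpa [hl] using hP l hl
  · intro p hp
    exact (Finset.mem_filter.mp hp).2
  · simp
  · simp
  · intro l hl
    have hpt : ((fun i => ε * (m i : ℝ), ξ) : (Fin d → ℝ) × (Fin d → ℝ)) -
        (fun i => ε * (((l i).toNat : ℕ) : ℝ), 0) =
        (fun i => ε * ((m - l) i : ℝ), ξ) := by
      ext i
      · have h0 : (0 : ℤ) ≤ l i := (Finset.mem_Ico.mp (Fintype.mem_piFinset.mp hl i)).1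
        have h1 : (((l i).toNat : ℕ) : ℝ) = (l i : ℝ) := by
          exact_mod_cast congrArg (Int.cast (R := ℝ)) (Int.toNat_of_nonneg h0)
        simp [h1]
        ring
      · simp
    rw [shiftAction_prod_shiftVar_pow, sub_sub_cancel, smul_eq_mul, hpt]
    rfl

end Averaging

/-- The optimal choice is `t = b / a`. Replacing `a, b` by `a + η, b + η` and letting `η → 0` covers
the cases where one of them vanishes. -/
theorem le_mul_mul_of_forall_le_add_div {X D a b : ℝ} (hD : 0 ≤ D) (ha : 0 ≤ a) (hb : 0 ≤ b)
    (h : ∀ t : ℝ, 0 < t → X ≤ D * ((t * a ^ 2 + b ^ 2 / t) / 2)) : X ≤ D * a * b := by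
  have hη : ∀ η : ℝ, 0 < η → X ≤ D * (a + η) * (b + η) := by
    intro η hη
    have ha' : 0 < a + η := by linarith
    have hb' : 0 < b + η := by linarith
    refine (h ((b + η) / (a + η)) (div_pos hb' ha')).trans ?_
    rw [mul_assoc]
    refine mul_le_mul_of_nonneg_left ?_ hD
    have h1 : (b + η) / (a + η) * a ^ 2 ≤ (a + η) * (b + η) := by
      rw [div_mul_eq_mul_div, div_le_iff₀ ha']
      have : a ^ 2 ≤ (a + η) ^ 2 := pow_le_pow_left₀ ha (by linarith) 2
      nlinarith
    have h2 : b ^ 2 / ((b + η) / (a + η)) ≤ (a + η) * (b + η) := by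
      rw [div_div_eq_mul_div, div_le_iff₀ hb']
      have : b ^ 2 ≤ (b + η) ^ 2 := pow_le_pow_left₀ hb (by linarith) 2
      nlinarith
    linarith
  have hlim : Filter.Tendsto (fun η : ℝ => D * (a + η) * (b + η)) (nhdsWithin 0 (Set.Ioi 0))
      (nhds (D * a * b)) := by
    have : Continuous fun η : ℝ => D * (a + η) * (b + η) := by fun_prop
    simpa using (this.tendsto 0).mono_left nhdsWithin_le_nhds
  exact ge_of_tendsto hlim (Filter.eventually_of_mem self_mem_nhdsWithin hη)

/-! ### Square sums of the weights. -/

section Weights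

theorem sum_inv_one_add_sq_le {N : ℕ} (hN : N ≠ 0) (s : Finset ℤ) :
    ∑ k ∈ s, (1 + ((k : ℝ) / N) ^ 2)⁻¹ ≤ 6 * (N : ℝ) := by
  have hN1 : (1 : ℝ) ≤ N := by exact_mod_cast Nat.one_le_iff_ne_zero.mpr hN
  have hN0 : (0 : ℝ) < N := by linarith
  -- A bounded increasing function whose increments dominate the summands up to the factor `3N`; the
  -- sum then telescopes, and `|φ| ≤ 1` gives `6N`.
  set φ : ℤ → ℝ := fun k => k / (N + |(k : ℝ)|) with hφ
  have hterm : ∀ k : ℤ, (1 + ((k : ℝ) / N) ^ 2)⁻¹ ≤ 3 * N * (φ (k + 1) - φ k) := by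
    intro k
    have hL : (1 + ((k : ℝ) / N) ^ 2)⁻¹ = N ^ 2 / (N ^ 2 + (k : ℝ) ^ 2) := by
      field_simp
    rcases le_or_gt 0 k with hk | hk
    · have hk0 : (0 : ℝ) ≤ k := by exact_mod_cast hk
      have hk2 : (k : ℝ) ≤ (k : ℝ) ^ 2 := by
        exact_mod_cast (by nlinarith [Int.le_self_sq k] : k ≤ k ^ 2)
      have hR : φ (k + 1) - φ k = N / ((N + k) * (N + k + 1)) := by
        simp only [hφ]
        push_cast
        rw [abs_of_nonneg hk0, abs_of_nonneg (by linarith : (0 : ℝ) ≤ k + 1)]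
        field_simp
        ring
      rw [hL, hR, mul_div_assoc', div_le_div_iff₀ (by positivity) (by positivity)]
      have : (N + (k : ℝ)) * (N + k + 1) ≤ 3 * (N ^ 2 + (k : ℝ) ^ 2) := by
        nlinarith [sq_nonneg ((N : ℝ) - k)]
      nlinarith [mul_le_mul_of_nonneg_left this (sq_nonneg (N : ℝ))]
    · have hk0 : (k : ℝ) + 1 ≤ 0 := by exact_mod_cast hk
      have hR : φ (k + 1) - φ k = N / ((N - k) * (N - k - 1)) := by
        simp only [hφ]
        push_cast
        rw [abs_of_nonpos (by linarith : (k : ℝ) ≤ 0), abs_of_nonpos hk0]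
        have h1 : (N : ℝ) + -k ≠ 0 := by linarith
        have h2 : (N : ℝ) + -(k + 1) ≠ 0 := by linarith
        have h3 : (N : ℝ) - k ≠ 0 := by linarith
        have h4 : (N : ℝ) - k - 1 ≠ 0 := by linarith
        rw [div_sub_div _ _ h2 h1, div_eq_div_iff (mul_ne_zero h2 h1) (mul_ne_zero h3 h4)]
        ring
      have h3 : 0 < (N : ℝ) - k := by linarith
      have h4 : 0 < (N : ℝ) - k - 1 := by linarith
      rw [hL, hR, mul_div_assoc', div_le_div_iff₀ (by positivity) (by positivity)]
      have : ((N : ℝ) - k) * (N - k - 1) ≤ 3 * (N ^ 2 + (k : ℝ) ^ 2) := by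
        nlinarith [sq_nonneg ((N : ℝ) + k)]
      nlinarith [mul_le_mul_of_nonneg_left this (sq_nonneg (N : ℝ))]
  have hφle : ∀ k, |φ k| ≤ 1 := by
    intro k
    simp only [hφ]
    rw [abs_div, abs_of_pos (by positivity : 0 < (N : ℝ) + |(k : ℝ)|),
      div_le_one (by positivity)]
    linarith
  obtain ⟨R, hR⟩ : ∃ R : ℕ, ∀ k ∈ s, k.natAbs < R :=
    ⟨s.sup Int.natAbs + 1, fun k hk => Nat.lt_succ_of_le (Finset.le_sup (f := Int.natAbs) hk)⟩
  have hsub : s ⊆ (Finset.range (2 * R)).image fun j : ℕ => -(R : ℤ) + j := by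
    intro k hk
    have := hR k hk
    refine Finset.mem_image.mpr ⟨(k + R).toNat, ?_, ?_⟩
    · rw [Finset.mem_range]; omega
    · omega
  calc ∑ k ∈ s, (1 + ((k : ℝ) / N) ^ 2)⁻¹
      ≤ ∑ k ∈ (Finset.range (2 * R)).image fun j : ℕ => -(R : ℤ) + j,
          (1 + ((k : ℝ) / N) ^ 2)⁻¹ :=
        Finset.sum_le_sum_of_subset_of_nonneg hsub fun _ _ _ => by positivity
    _ = ∑ j ∈ Finset.range (2 * R), (1 + (((-(R : ℤ) + j : ℤ) : ℝ) / N) ^ 2)⁻¹ :=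
        Finset.sum_image fun a _ b _ h => by simpa using h
    _ ≤ ∑ j ∈ Finset.range (2 * R),
          3 * N * (φ (-(R : ℤ) + (j + 1 : ℕ)) - φ (-(R : ℤ) + j)) := by
        refine Finset.sum_le_sum fun j _ => (hterm _).trans (le_of_eq ?_)
        push_cast
        rw [add_assoc]
    _ = 3 * N * (φ (-(R : ℤ) + (2 * R : ℕ)) - φ (-(R : ℤ) + (0 : ℕ))) := by
        rw [← Finset.mul_sum, Finset.sum_range_sub fun j : ℕ => φ (-(R : ℤ) + j)]
    _ ≤ 6 * (N : ℝ) := by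
        have h1 := abs_le.mp (hφle (-(R : ℤ) + (2 * R : ℕ)))
        have h2 := abs_le.mp (hφle (-(R : ℤ) + (0 : ℕ)))
        nlinarith

/-- Enlarging `P` to the product of its coordinate projections makes the sum factor into
one-dimensional ones. -/
theorem sum_prod_inv_one_add_sq_le {d N : ℕ} (hN : N ≠ 0) (P : Finset (Fin d → ℤ))
    (n : Fin d → ℤ) :
    ∑ p ∈ P, ∏ i, (1 + (((n - p) i : ℝ) / N) ^ 2)⁻¹ ≤ (6 * (N : ℝ)) ^ d := by
  have hsub : P ⊆ Fintype.piFinset fun i => P.image fun p => p i := fun p hp =>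
    Fintype.mem_piFinset.mpr fun i => Finset.mem_image_of_mem _ hp
  refine (Finset.sum_le_sum_of_subset_of_nonneg hsub fun _ _ _ =>
    Finset.prod_nonneg fun _ _ => by positivity).trans ?_
  have h := Finset.prod_univ_sum (fun i => P.image fun p => p i)
    fun (i : Fin d) (k : ℤ) => (1 + (((n i - k : ℤ) : ℝ) / N) ^ 2)⁻¹
  simp only [Pi.sub_apply]
  rw [← h]
  have hone : ∀ i, ∑ k ∈ P.image (fun p => p i), (1 + (((n i - k : ℤ) : ℝ) / N) ^ 2)⁻¹ ≤
      6 * (N : ℝ) := by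
    intro i
    rw [← Finset.sum_image (f := fun k : ℤ => (1 + ((k : ℝ) / N) ^ 2)⁻¹) (g := fun k => n i - k)
      fun a _ b _ h => by simpa using h]
    exact sum_inv_one_add_sq_le hN _
  refine (Finset.prod_le_prod (fun i _ => Finset.sum_nonneg fun _ _ => by positivity)
    fun i _ => hone i).trans ?_
  simp

theorem norm_sq_one_add_I_mul (t : ℤ) (N : ℕ) :
    ‖(1 : ℂ) + Complex.I * t / N‖ ^ 2 = 1 + ((t : ℝ) / N) ^ 2 := by
  have h : (1 : ℂ) + Complex.I * t / N = ((1 : ℝ) : ℂ) + (((t : ℝ) / N : ℝ) : ℂ) * Complex.I := by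
    push_cast
    ring
  rw [h, Complex.sq_norm, Complex.normSq_add_mul_I]
  ring

theorem norm_sq_phaseWeight {d : ℕ} (N : ℕ) (k : Fin d → ℤ) :
    ‖phaseWeight N k‖ ^ 2 = ∏ i, (1 + ((k i : ℝ) / N) ^ 2) := by
  rw [phaseWeight, norm_prod, ← Finset.prod_pow]
  simp only [norm_sq_one_add_I_mul]

theorem phaseWeight_ne_zero {d : ℕ} (N : ℕ) (k : Fin d → ℤ) : phaseWeight N k ≠ 0 := by
  rw [← norm_ne_zero_iff, ← pow_ne_zero_iff two_ne_zero, norm_sq_phaseWeight]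
  exact Finset.prod_ne_zero_iff.mpr fun i _ => by positivity

theorem sum_norm_sq_inv_phaseWeight_le {d N : ℕ} (hN : N ≠ 0) (P : Finset (Fin d → ℤ))
    (n : Fin d → ℤ) : ∑ p ∈ P, ‖(phaseWeight N (n - p))⁻¹‖ ^ 2 ≤ (6 * (N : ℝ)) ^ d := by
  simp only [norm_inv, inv_pow, norm_sq_phaseWeight, ← Finset.prod_inv_distrib]
  exact sum_prod_inv_one_add_sq_le hN P n

theorem le_one_of_mem_cubeIndices {d : ℕ} {σ : Fin d → ℕ} (hσ : σ ∈ cubeIndices d) (i : Fin d) :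
    σ i ≤ 1 :=
  Nat.le_of_lt_succ (Finset.mem_range.mp (Fintype.mem_piFinset.mp hσ i))

/-- On the cell `0 ≤ k_i < N`, so `|N - 1 - k_i| ≤ N` and `|1 + i k_i/N| ≤ 2`. This localisation is
what keeps the growing factors of `phaseCoeff` harmless. -/
theorem norm_cellWeight_mul_phaseCoeff_le {d N : ℕ} (hN : N ≠ 0) {σ τ : Fin d → ℕ}
    (k : Fin d → ℤ) :
    ‖cellWeight N σ k * phaseCoeff N τ k‖ ≤
      if k ∈ latticeCell d N then
        2 ^ d * ((N : ℝ) ^ (∑ i, σ i) / (N : ℝ) ^ (∑ i, τ i)) / N ^ d else 0 := by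
  have hN0 : (0 : ℝ) < N := by exact_mod_cast Nat.pos_of_ne_zero hN
  rw [cellWeight]
  split_ifs with hk
  · rw [phaseCoeff, ← Finset.prod_mul_distrib, norm_prod]
    have hfac : ∀ i, ‖avgWeight N (σ i) (k i) *
        ((1 + Complex.I * k i / N) ^ (1 - τ i) * (-1 / N) ^ τ i)‖ ≤
          2 * ((N : ℝ) ^ σ i / (N : ℝ) ^ τ i) / N := by
      intro i
      have hki := Finset.mem_Ico.mp (Fintype.mem_piFinset.mp hk i)
      have hk0 : (0 : ℝ) ≤ k i := by exact_mod_cast hki.1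
      have hk1 : (k i : ℝ) + 1 ≤ N := by exact_mod_cast hki.2
      have h1 : ‖avgWeight N (σ i) (k i)‖ ≤ (N : ℝ) ^ σ i / N := by
        have : ((N : ℂ) - 1 - k i) = (((N : ℝ) - 1 - k i : ℝ) : ℂ) := by push_cast; ring
        rw [avgWeight, norm_div, norm_pow, this, Complex.norm_real, Real.norm_of_nonneg
          (by linarith), Complex.norm_natCast]
        gcongr
        · linarith
        · linarith
      have h2 : ‖(1 : ℂ) + Complex.I * k i / N‖ ≤ 2 := by
        refine (norm_add_le _ _).trans ?_
        rw [norm_one, norm_div, norm_mul, Complex.norm_I, one_mul, Complex.norm_intCast,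
          Complex.norm_natCast, abs_of_nonneg hk0]
        have : (k i : ℝ) / N ≤ 1 := (div_le_one hN0).mpr (by linarith)
        linarith
      have h3 : ‖(1 : ℂ) + Complex.I * k i / N‖ ^ (1 - τ i) ≤ 2 := by
        refine (pow_le_pow_left₀ (norm_nonneg _) h2 _).trans ?_
        refine (pow_le_pow_right₀ (by norm_num : (1 : ℝ) ≤ 2) (Nat.sub_le 1 (τ i))).trans ?_
        norm_num
      have h4 : ‖(-1 / N : ℂ)‖ ^ τ i = 1 / (N : ℝ) ^ τ i := by
        rw [norm_div, norm_neg, norm_one, Complex.norm_natCast, one_div, inv_pow, one_div]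
      rw [norm_mul, norm_mul, norm_pow, norm_pow, h4]
      calc _ ≤ (N : ℝ) ^ σ i / N * (2 * (1 / (N : ℝ) ^ τ i)) := by gcongr
        _ = _ := by ring
    refine (Finset.prod_le_prod (fun _ _ => norm_nonneg _) fun i _ => hfac i).trans (le_of_eq ?_)
    simp [Finset.prod_div_distrib, Finset.prod_mul_distrib, Finset.prod_pow_eq_pow_sum]
  · simp

theorem sum_norm_sq_cellWeight_mul_phaseCoeff_le {d N : ℕ} (hN : N ≠ 0) {σ τ : Fin d → ℕ}
    (P : Finset (Fin d → ℤ)) (m : Fin d → ℤ) :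
    ∑ p ∈ P, ‖cellWeight N σ (m - p) * phaseCoeff N τ (m - p)‖ ^ 2 ≤
      N ^ d * (2 ^ d * ((N : ℝ) ^ (∑ i, σ i) / (N : ℝ) ^ (∑ i, τ i)) / N ^ d) ^ 2 := by
  set c : ℝ := 2 ^ d * ((N : ℝ) ^ (∑ i, σ i) / (N : ℝ) ^ (∑ i, τ i)) / N ^ d with hc
  have hcard : (P.filter fun p => m - p ∈ latticeCell d N).card ≤ N ^ d := by
    have h := Finset.card_le_card_of_injOn (s := P.filter fun p => m - p ∈ latticeCell d N)
      (t := latticeCell d N) (fun p => m - p) (fun p hp => (Finset.mem_filter.mp hp).2)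
      (fun a _ b _ h => by simpa using h)
    refine h.trans (le_of_eq ?_)
    simp [latticeCell]
  calc ∑ p ∈ P, ‖cellWeight N σ (m - p) * phaseCoeff N τ (m - p)‖ ^ 2
      ≤ ∑ p ∈ P, if m - p ∈ latticeCell d N then c ^ 2 else 0 := by
        refine Finset.sum_le_sum fun p _ => ?_
        refine (pow_le_pow_left₀ (norm_nonneg _)
          (norm_cellWeight_mul_phaseCoeff_le hN (m - p)) 2).trans (le_of_eq ?_)
        split_ifs <;> simp [hc]
    _ = (P.filter fun p => m - p ∈ latticeCell d N).card * c ^ 2 := by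
        rw [← Finset.sum_filter, Finset.sum_const, nsmul_eq_mul]
    _ ≤ N ^ d * c ^ 2 := by
        gcongr
        exact_mod_cast hcard

end Weights

/-! ### The bilinear form on finitely supported sequences. -/

section Bilinear

variable {d : ℕ} {F : (Fin d → ℝ) × (Fin d → ℝ) → ℂ}

theorem integral_norm_sq_trigPoly_neg (A : Finset (Fin d → ℤ)) (c : (Fin d → ℤ) → ℂ) :
    ∫ ξ in torusBox d, ‖∑ n ∈ A, c n * torusChar (-n) ξ‖ ^ 2 =
      (2 * Real.pi) ^ d * ∑ n ∈ A, ‖c n‖ ^ 2 := by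
  have h : ∀ ξ, ‖∑ n ∈ A, c n * torusChar (-n) ξ‖ =
      ‖∑ n ∈ A, (starRingEnd ℂ) (c n) * torusChar n ξ‖ := by
    intro ξ
    rw [← RCLike.norm_conj, map_sum]
    simp only [map_mul, conj_torusChar, neg_neg]
  simp only [h, integral_norm_sq_trigPoly, RCLike.norm_conj]

theorem continuous_trigPoly (A : Finset (Fin d → ℤ)) (c : (Fin d → ℤ) → ℂ)
    (f : (Fin d → ℤ) → Fin d → ℤ) :
    Continuous fun ξ => ∑ n ∈ A, c n * torusChar (f n) ξ :=
  continuous_finsetSum _ fun n _ => continuous_const.mul (contDiff_torusChar (f n)).continuous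

/-- AM-GM with a free parameter replaces Cauchy-Schwarz: the bound is additive, so it can be summed
over `p`, `σ` and `τ` with `t` optimised only once, at the end. -/
theorem norm_integral_mul_mul_le {U V H : (Fin d → ℝ) → ℂ} (hU : Continuous U)
    (hV : Continuous V) {K t : ℝ} (ht : 0 < t) (hK : ∀ ξ, ‖H ξ‖ ≤ K) :
    ‖∫ ξ in torusBox d, V ξ * U ξ * H ξ‖ ≤
      K * ((t * ∫ ξ in torusBox d, ‖U ξ‖ ^ 2) + (∫ ξ in torusBox d, ‖V ξ‖ ^ 2) / t) / 2 := by
  have hintU : IntegrableOn (fun ξ => ‖U ξ‖ ^ 2) (torusBox d) :=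
    (hU.norm.pow 2).continuousOn.integrableOn_compact (isCompact_torusBox d)
  have hintV : IntegrableOn (fun ξ => ‖V ξ‖ ^ 2) (torusBox d) :=
    (hV.norm.pow 2).continuousOn.integrableOn_compact (isCompact_torusBox d)
  have hint : IntegrableOn (fun ξ => K * (t * ‖U ξ‖ ^ 2 + ‖V ξ‖ ^ 2 / t) / 2) (torusBox d) :=
    (((hintU.const_mul t).add (hintV.div_const t)).const_mul K).div_const 2
  refine (norm_integral_le_of_norm_le hint (Filter.Eventually.of_forall fun ξ => ?_)).trans
    (le_of_eq ?_)
  · have hK0 : 0 ≤ K := (norm_nonneg _).trans (hK ξ)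
    have hamgm : ‖V ξ‖ * ‖U ξ‖ ≤ (t * ‖U ξ‖ ^ 2 + ‖V ξ‖ ^ 2 / t) / 2 := by
      have h := div_nonneg (sq_nonneg (t * ‖U ξ‖ - ‖V ξ‖)) ht.le
      have h2 : (t * ‖U ξ‖ - ‖V ξ‖) ^ 2 / t =
          t * ‖U ξ‖ ^ 2 + ‖V ξ‖ ^ 2 / t - 2 * (‖V ξ‖ * ‖U ξ‖) := by
        field_simp
        ring
      linarith
    rw [norm_mul, norm_mul]
    calc ‖V ξ‖ * ‖U ξ‖ * ‖H ξ‖ ≤ (t * ‖U ξ‖ ^ 2 + ‖V ξ‖ ^ 2 / t) / 2 * K := by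
          gcongr
          exact hK ξ
      _ = _ := by ring
  · rw [integral_div, integral_const_mul, integral_add (hintU.const_mul t) (hintV.div_const t),
      integral_const_mul, integral_div]

/-- The decoupling formula: apart from the character, each summand is a function of `m - p` times a
function of `n - p`, and the symbol is evaluated at `p`. -/
theorem integral_torusChar_mul_eq_sum (hF : IsTorusSmooth F) {N : ℕ} (hN : N ≠ 0) (ε : ℝ)
    (m n : Fin d → ℤ) (P : Finset (Fin d → ℤ)) (hP : ∀ l ∈ latticeCell d N, m - l ∈ P) :
    ∫ ξ in torusBox d, torusChar (n - m) ξ * F (fun i => ε * (m i : ℝ), ξ) =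
      ∑ σ ∈ cubeIndices d, ∑ τ ∈ cubeIndices d, ∑ p ∈ P,
        cellWeight N σ (m - p) * phaseCoeff N τ (m - p) * (phaseWeight N (n - p))⁻¹ *
          ∫ ξ in torusBox d, torusChar (n - m) ξ *
            freqDeriv τ (shiftAction d ε (latticeDiff d σ) F) (fun i => ε * (p i : ℝ), ξ) := by
  have hG : ∀ σ, IsTorusSmooth (shiftAction d ε (latticeDiff d σ) F) := fun σ =>
    hF.shiftAction _
  have hint : ∀ σ p, IntegrableOn (fun ξ => cellWeight N σ (m - p) * (torusChar (n - m) ξ *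
      shiftAction d ε (latticeDiff d σ) F (fun i => ε * (p i : ℝ), ξ))) (torusBox d) :=
    fun σ p => integrableOn_torusBox (continuous_const.mul
      ((contDiff_torusChar _).continuous.mul ((hG σ).continuous_snd _)))
  have hexp : ∀ ξ, torusChar (n - m) ξ * F (fun i => ε * (m i : ℝ), ξ) =
      ∑ σ ∈ cubeIndices d, ∑ p ∈ P, cellWeight N σ (m - p) * (torusChar (n - m) ξ *
        shiftAction d ε (latticeDiff d σ) F (fun i => ε * (p i : ℝ), ξ)) := by
    intro ξ
    rw [eq_sum_cellWeight_mul_latticeDiff hN ε F m P hP ξ, Finset.mul_sum]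
    refine Finset.sum_congr rfl fun σ _ => ?_
    rw [Finset.mul_sum]
    exact Finset.sum_congr rfl fun p _ => by ring
  simp only [hexp]
  rw [integral_finsetSum _ fun σ _ => integrable_finsetSum _ fun p _ => hint σ p]
  refine Finset.sum_congr rfl fun σ _ => ?_
  rw [integral_finsetSum _ fun p _ => hint σ p, Finset.sum_comm]
  refine Finset.sum_congr rfl fun p _ => ?_
  rw [integral_const_mul]
  have hW := phaseWeight_ne_zero N (n - p)
  have h := phaseWeight_mul_integral (hG σ) N m n p (fun i => ε * (p i : ℝ))
  rw [← mul_right_inj' hW, mul_left_comm, h, Finset.mul_sum, Finset.mul_sum]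
  refine Finset.sum_congr rfl fun τ _ => ?_
  field_simp

theorem sum_sum_mul_integral_torusChar (S T : Finset (Fin d → ℤ)) (b c : (Fin d → ℤ) → ℂ)
    {H : (Fin d → ℝ) → ℂ} (hH : Continuous H) :
    ∑ m ∈ S, ∑ n ∈ T, b m * c n * ∫ ξ in torusBox d, torusChar (n - m) ξ * H ξ =
      ∫ ξ in torusBox d, (∑ m ∈ S, b m * torusChar (-m) ξ) *
        (∑ n ∈ T, c n * torusChar n ξ) * H ξ := by
  have hexp : ∀ ξ, (∑ m ∈ S, b m * torusChar (-m) ξ) * (∑ n ∈ T, c n * torusChar n ξ) * H ξ =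
      ∑ m ∈ S, ∑ n ∈ T, b m * c n * (torusChar (n - m) ξ * H ξ) := by
    intro ξ
    rw [Finset.sum_mul_sum, Finset.sum_mul]
    refine Finset.sum_congr rfl fun m _ => ?_
    rw [Finset.sum_mul]
    refine Finset.sum_congr rfl fun n _ => ?_
    rw [sub_eq_neg_add, torusChar_add]
    ring
  have hint : ∀ m n, IntegrableOn (fun ξ => b m * c n * (torusChar (n - m) ξ * H ξ))
      (torusBox d) := fun m n =>
    integrableOn_torusBox (continuous_const.mul ((contDiff_torusChar _).continuous.mul hH))
  simp only [hexp]
  rw [integral_finsetSum _ fun m _ => integrable_finsetSum _ fun n _ => hint m n]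
  refine Finset.sum_congr rfl fun m _ => ?_
  rw [integral_finsetSum _ fun n _ => hint m n]
  exact Finset.sum_congr rfl fun n _ => (integral_const_mul _ _).symm

/-- The contribution of one pair of multi-indices to the bilinear form. -/
theorem norm_sum_weighted_integral_le {N : ℕ} (hN : N ≠ 0) {σ τ : Fin d → ℕ} (ε : ℝ)
    (hF : IsTorusSmooth F) {K t : ℝ} (ht : 0 < t) (hK0 : 0 ≤ K)
    (hK : ∀ p, ‖F p‖ ≤ K * ((N : ℝ) ^ (∑ i, τ i) / (N : ℝ) ^ (∑ i, σ i)))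
    (S T P : Finset (Fin d → ℤ)) (u v : (Fin d → ℤ) → ℂ) :
    ‖∑ p ∈ P, ∑ m ∈ S, ∑ n ∈ T,
        (v m * (cellWeight N σ (m - p) * phaseCoeff N τ (m - p))) *
          (u n * (phaseWeight N (n - p))⁻¹) *
          ∫ ξ in torusBox d, torusChar (n - m) ξ * F (fun i => ε * (p i : ℝ), ξ)‖ ≤
      (2 * Real.pi) ^ d * 12 ^ d * K *
        ((t * ∑ n ∈ T, ‖u n‖ ^ 2 + (∑ m ∈ S, ‖v m‖ ^ 2) / t) / 2) := by
  have hN0 : (0 : ℝ) < N := by exact_mod_cast Nat.pos_of_ne_zero hN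
  set c : ℝ := 2 ^ d * ((N : ℝ) ^ (∑ i, σ i) / (N : ℝ) ^ (∑ i, τ i)) / N ^ d with hc
  set L : ℝ := K * ((N : ℝ) ^ (∑ i, τ i) / (N : ℝ) ^ (∑ i, σ i)) with hL
  have hc0 : 0 < c := by positivity
  have hL0 : 0 ≤ L := by positivity
  -- The cancellation of all powers of `N`, which makes the final bound uniform in `ε`.
  have hLc : L * c * N ^ d = 2 ^ d * K := by
    simp only [hc, hL]
    field_simp
  have hU : ∑ p ∈ P, ∑ n ∈ T, ‖u n * (phaseWeight N (n - p))⁻¹‖ ^ 2 ≤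
      (6 * N) ^ d * ∑ n ∈ T, ‖u n‖ ^ 2 := by
    rw [Finset.sum_comm, Finset.mul_sum]
    refine Finset.sum_le_sum fun n _ => ?_
    simp only [norm_mul, mul_pow]
    rw [← Finset.mul_sum, mul_comm]
    have := sum_norm_sq_inv_phaseWeight_le hN P n
    rw [mul_pow] at this
    gcongr
  have hV : ∑ p ∈ P, ∑ m ∈ S, ‖v m * (cellWeight N σ (m - p) * phaseCoeff N τ (m - p))‖ ^ 2 ≤
      N ^ d * c ^ 2 * ∑ m ∈ S, ‖v m‖ ^ 2 := by
    rw [Finset.sum_comm, Finset.mul_sum]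
    refine Finset.sum_le_sum fun m _ => ?_
    have h : ∀ p, ‖v m * (cellWeight N σ (m - p) * phaseCoeff N τ (m - p))‖ ^ 2 =
        ‖v m‖ ^ 2 * ‖cellWeight N σ (m - p) * phaseCoeff N τ (m - p)‖ ^ 2 := fun p => by
      rw [norm_mul, mul_pow]
    simp only [h]
    rw [← Finset.mul_sum, mul_comm]
    exact mul_le_mul_of_nonneg_right (sum_norm_sq_cellWeight_mul_phaseCoeff_le hN P m)
      (sq_nonneg _)
  -- The parameter is rescaled by `c` because the square sums of the two weights are `(6N)^d` and
  -- `N^d c²`; both terms then carry the same factor `c N^d`.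
  have htc : 0 < t * c := mul_pos ht hc0
  have hstep : ∀ p ∈ P, ‖∑ m ∈ S, ∑ n ∈ T,
      (v m * (cellWeight N σ (m - p) * phaseCoeff N τ (m - p))) *
        (u n * (phaseWeight N (n - p))⁻¹) *
        ∫ ξ in torusBox d, torusChar (n - m) ξ * F (fun i => ε * (p i : ℝ), ξ)‖ ≤
      L * (t * c * ((2 * Real.pi) ^ d * ∑ n ∈ T, ‖u n * (phaseWeight N (n - p))⁻¹‖ ^ 2) +
        (2 * Real.pi) ^ d *
          (∑ m ∈ S, ‖v m * (cellWeight N σ (m - p) * phaseCoeff N τ (m - p))‖ ^ 2) / (t * c)) /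
        2 := by
    intro p _
    rw [sum_sum_mul_integral_torusChar S T _ _ (hF.continuous_snd _),
      ← integral_norm_sq_trigPoly, ← integral_norm_sq_trigPoly_neg]
    exact norm_integral_mul_mul_le (continuous_trigPoly T _ id) (continuous_trigPoly S _ Neg.neg)
      htc fun ξ => hK _
  refine (norm_sum_le_of_le P hstep).trans ?_
  rw [← Finset.sum_div, ← Finset.mul_sum, Finset.sum_add_distrib, ← Finset.mul_sum,
    ← Finset.mul_sum, ← Finset.sum_div, ← Finset.mul_sum]
  -- Only the `u`-term carries `6^d`; giving it to the `v`-term as well restores the symmetric form.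
  have hsix : (1 : ℝ) ≤ 6 ^ d := one_le_pow₀ (by norm_num)
  have hSv : 0 ≤ ∑ m ∈ S, ‖v m‖ ^ 2 := Finset.sum_nonneg fun _ _ => sq_nonneg _
  calc _ ≤ L * (t * c * ((2 * Real.pi) ^ d * ((6 * N) ^ d * ∑ n ∈ T, ‖u n‖ ^ 2)) +
        (2 * Real.pi) ^ d * (N ^ d * c ^ 2 * ∑ m ∈ S, ‖v m‖ ^ 2) / (t * c)) / 2 := by
        gcongr
    _ = (2 * Real.pi) ^ d * (L * c * N ^ d) *
        ((6 ^ d * (t * ∑ n ∈ T, ‖u n‖ ^ 2) + 1 * ((∑ m ∈ S, ‖v m‖ ^ 2) / t)) / 2) := by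
        rw [mul_pow 6]
        field_simp
    _ ≤ (2 * Real.pi) ^ d * (L * c * N ^ d) *
        ((6 ^ d * (t * ∑ n ∈ T, ‖u n‖ ^ 2) + 6 ^ d * ((∑ m ∈ S, ‖v m‖ ^ 2) / t)) / 2) := by
        have : 0 ≤ (∑ m ∈ S, ‖v m‖ ^ 2) / t := by positivity
        have : 0 ≤ L * c * N ^ d := by positivity
        gcongr
    _ = _ := by
        rw [hLc, show (12 : ℝ) = 2 * 6 by norm_num, mul_pow 2 6]
        ring

/-- The bilinear form of a lattice pseudo-differential operator is bounded on `ℓ²`. -/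
theorem norm_bilinear_le (hF : IsTorusSmooth F) {N : ℕ} (hN : N ≠ 0) (ε : ℝ)
    {C : (Fin d → ℕ) → (Fin d → ℕ) → ℝ} (hC0 : ∀ σ τ, 0 ≤ C σ τ)
    (hC : ∀ σ ∈ cubeIndices d, ∀ τ ∈ cubeIndices d, ∀ p,
      ‖freqDeriv τ (shiftAction d ε (latticeDiff d σ) F) p‖ ≤
        C σ τ * ((N : ℝ) ^ (∑ i, τ i) / (N : ℝ) ^ (∑ i, σ i)))
    (S T : Finset (Fin d → ℤ)) (u v : (Fin d → ℤ) → ℂ) :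
    ‖∑ m ∈ S, ∑ n ∈ T, v m * u n *
        ∫ ξ in torusBox d, torusChar (n - m) ξ * F (fun i => ε * (m i : ℝ), ξ)‖ ≤
      (2 * Real.pi) ^ d * 12 ^ d * (∑ σ ∈ cubeIndices d, ∑ τ ∈ cubeIndices d, C σ τ) *
        √(∑ n ∈ T, ‖u n‖ ^ 2) * √(∑ m ∈ S, ‖v m‖ ^ 2) := by
  have hCsum : 0 ≤ ∑ σ ∈ cubeIndices d, ∑ τ ∈ cubeIndices d, C σ τ :=
    Finset.sum_nonneg fun σ _ => Finset.sum_nonneg fun τ _ => hC0 σ τ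
  refine le_mul_mul_of_forall_le_add_div (by positivity) (Real.sqrt_nonneg _)
    (Real.sqrt_nonneg _) fun t ht => ?_
  rw [Real.sq_sqrt (Finset.sum_nonneg fun _ _ => sq_nonneg _),
    Real.sq_sqrt (Finset.sum_nonneg fun _ _ => sq_nonneg _)]
  -- A finite set of base points that serves every `m ∈ S` at once.
  set P : Finset (Fin d → ℤ) := (S ×ˢ latticeCell d N).image fun q => q.1 - q.2
  have hP : ∀ m ∈ S, ∀ l ∈ latticeCell d N, m - l ∈ P := fun m hm l hl =>
    Finset.mem_image.mpr ⟨(m, l), Finset.mk_mem_product hm hl, rfl⟩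
  have heq : ∑ m ∈ S, ∑ n ∈ T, v m * u n *
      ∫ ξ in torusBox d, torusChar (n - m) ξ * F (fun i => ε * (m i : ℝ), ξ) =
      ∑ σ ∈ cubeIndices d, ∑ τ ∈ cubeIndices d, ∑ p ∈ P, ∑ m ∈ S, ∑ n ∈ T,
        (v m * (cellWeight N σ (m - p) * phaseCoeff N τ (m - p))) *
          (u n * (phaseWeight N (n - p))⁻¹) *
          ∫ ξ in torusBox d, torusChar (n - m) ξ *
            freqDeriv τ (shiftAction d ε (latticeDiff d σ) F) (fun i => ε * (p i : ℝ), ξ) := by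
    have h1 : ∀ m ∈ S, ∀ n ∈ T, v m * u n *
        ∫ ξ in torusBox d, torusChar (n - m) ξ * F (fun i => ε * (m i : ℝ), ξ) =
        ∑ σ ∈ cubeIndices d, ∑ τ ∈ cubeIndices d, ∑ p ∈ P,
          (v m * (cellWeight N σ (m - p) * phaseCoeff N τ (m - p))) *
          (u n * (phaseWeight N (n - p))⁻¹) *
          ∫ ξ in torusBox d, torusChar (n - m) ξ *
            freqDeriv τ (shiftAction d ε (latticeDiff d σ) F) (fun i => ε * (p i : ℝ), ξ) := by
      intro m hm n _
      rw [integral_torusChar_mul_eq_sum hF hN ε m n P (hP m hm)]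
      simp only [Finset.mul_sum]
      refine Finset.sum_congr rfl fun σ _ => Finset.sum_congr rfl fun τ _ =>
        Finset.sum_congr rfl fun p _ => by ring
    rw [Finset.sum_congr rfl fun m hm => Finset.sum_congr rfl (h1 m hm)]
    simp only [Finset.sum_comm (s := T) (t := cubeIndices d), Finset.sum_comm (s := T) (t := P)]
    simp only [Finset.sum_comm (s := S) (t := cubeIndices d), Finset.sum_comm (s := S) (t := P)]
  rw [heq, Finset.mul_sum, Finset.sum_mul]
  refine norm_sum_le_of_le _ fun σ hσ => ?_
  rw [Finset.mul_sum, Finset.sum_mul]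
  refine norm_sum_le_of_le _ fun τ hτ => ?_
  exact norm_sum_weighted_integral_le hN ε ((hF.shiftAction _).listDeriv _ _ _) ht (hC0 σ τ)
    (hC σ hσ τ hτ) S T P u v

end Bilinear

/-! ### From bounded forms to bounded operators on `ℓ²`. -/

section Matrix

variable {ι : Type*} {A : ι → ι → ℂ} {D : ℝ}

/-- The matrix `A` has bilinear form bounded by `D` on finitely supported sequences. -/
def IsBoundedForm (A : ι → ι → ℂ) (D : ℝ) : Prop :=
  ∀ (S T : Finset ι) (u v : ι → ℂ), ‖∑ m ∈ S, ∑ n ∈ T, v m * u n * A m n‖ ≤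
    D * √(∑ n ∈ T, ‖u n‖ ^ 2) * √(∑ m ∈ S, ‖v m‖ ^ 2)

theorem le_sq_of_le_mul_sqrt {X D : ℝ} (hX : 0 ≤ X) (h : X ≤ D * √X) : X ≤ D ^ 2 := by
  rcases hX.eq_or_lt with rfl | hX0
  · positivity
  · have hs : 0 < √X := Real.sqrt_pos.mpr hX0
    have h1 : √X * √X ≤ D * √X := by rwa [Real.mul_self_sqrt hX]
    have h2 : √X ≤ D := le_of_mul_le_mul_right h1 hs
    calc X = √X ^ 2 := (Real.sq_sqrt hX).symm
      _ ≤ D ^ 2 := pow_le_pow_left₀ hs.le h2 2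

theorem memℓp_two_iff {u : ι → ℂ} : Memℓp u 2 ↔ Summable fun n => ‖u n‖ ^ 2 := by
  rw [memℓp_gen_iff (by norm_num)]
  norm_num

theorem norm_ellTwo_eq (f : lp (fun _ : ι => ℂ) 2) : ‖f‖ = √(∑' n, ‖f n‖ ^ 2) := by
  rw [lp.norm_eq_tsum_rpow (by norm_num), Real.sqrt_eq_rpow]
  norm_num

/-- Test the form on a single row against the conjugate of that row: the square sum `X` satisfies `X
≤ D √X`. -/
theorem IsBoundedForm.summable_row_sq (hA : IsBoundedForm A D) (m : ι) :
    Summable fun n => ‖A m n‖ ^ 2 := by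
  refine summable_of_sum_le (c := D ^ 2) (fun n => sq_nonneg _) fun T => ?_
  have h0 : 0 ≤ ∑ n ∈ T, ‖A m n‖ ^ 2 := Finset.sum_nonneg fun _ _ => sq_nonneg _
  have h := hA {m} T (fun n => (starRingEnd ℂ) (A m n)) fun _ => 1
  simp only [Finset.sum_singleton, one_mul, RCLike.norm_conj, norm_one, one_pow, Real.sqrt_one,
    mul_one, Complex.conj_mul'] at h
  have hcast : ∑ n ∈ T, (‖A m n‖ : ℂ) ^ 2 = ((∑ n ∈ T, ‖A m n‖ ^ 2 : ℝ) : ℂ) := by push_cast; rfl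
  rw [hcast, Complex.norm_real, Real.norm_of_nonneg h0] at h
  exact le_sq_of_le_mul_sqrt h0 h

theorem IsBoundedForm.summable_row_mul (hA : IsBoundedForm A D) {u : ι → ℂ} (hu : Memℓp u 2)
    (m : ι) : Summable fun n => A m n * u n := by
  refine Summable.of_norm_bounded
    (((hA.summable_row_sq m).add (memℓp_two_iff.mp hu)).div_const 2) fun n => ?_
  rw [norm_mul]
  nlinarith [sq_nonneg (‖A m n‖ - ‖u n‖)]

theorem IsBoundedForm.norm_sum_mul_tsum_le (hA : IsBoundedForm A D) (hD : 0 ≤ D) {u : ι → ℂ}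
    (hu : Memℓp u 2) (S : Finset ι) (v : ι → ℂ) :
    ‖∑ m ∈ S, v m * ∑' n, A m n * u n‖ ≤
      D * √(∑' n, ‖u n‖ ^ 2) * √(∑ m ∈ S, ‖v m‖ ^ 2) := by
  have hlim : Filter.Tendsto (fun T : Finset ι => ‖∑ m ∈ S, v m * ∑ n ∈ T, A m n * u n‖)
      Filter.atTop (nhds ‖∑ m ∈ S, v m * ∑' n, A m n * u n‖) :=
    (tendsto_finsetSum _ fun m _ => (hA.summable_row_mul hu m).hasSum.const_mul (v m)).norm
  refine le_of_tendsto hlim (Filter.Eventually.of_forall fun T => ?_)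
  have h := hA S T u v
  have heq : ∑ m ∈ S, v m * ∑ n ∈ T, A m n * u n = ∑ m ∈ S, ∑ n ∈ T, v m * u n * A m n := by
    simp only [Finset.mul_sum]
    exact Finset.sum_congr rfl fun m _ => Finset.sum_congr rfl fun n _ => by ring
  rw [heq]
  refine h.trans ?_
  gcongr
  exact (memℓp_two_iff.mp hu).sum_le_tsum T fun _ _ => sq_nonneg _

/-- Duality: test against the conjugate of the image sequence. -/
theorem IsBoundedForm.sum_norm_sq_tsum_le (hA : IsBoundedForm A D) (hD : 0 ≤ D) {u : ι → ℂ}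
    (hu : Memℓp u 2) (S : Finset ι) :
    ∑ m ∈ S, ‖∑' n, A m n * u n‖ ^ 2 ≤ (D * √(∑' n, ‖u n‖ ^ 2)) ^ 2 := by
  have h0 : 0 ≤ ∑ m ∈ S, ‖∑' n, A m n * u n‖ ^ 2 := Finset.sum_nonneg fun _ _ => sq_nonneg _
  have h := hA.norm_sum_mul_tsum_le hD hu S fun m => (starRingEnd ℂ) (∑' n, A m n * u n)
  simp only [RCLike.norm_conj, Complex.conj_mul'] at h
  have hcast : ∑ m ∈ S, (‖∑' n, A m n * u n‖ : ℂ) ^ 2 =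
      ((∑ m ∈ S, ‖∑' n, A m n * u n‖ ^ 2 : ℝ) : ℂ) := by push_cast; rfl
  rw [hcast, Complex.norm_real, Real.norm_of_nonneg h0] at h
  exact le_sq_of_le_mul_sqrt h0 h

theorem IsBoundedForm.memℓp_tsum (hA : IsBoundedForm A D) (hD : 0 ≤ D) {u : ι → ℂ}
    (hu : Memℓp u 2) : Memℓp (fun m => ∑' n, A m n * u n) 2 :=
  memℓp_two_iff.mpr
    (summable_of_sum_le (fun _ => sq_nonneg _) (hA.sum_norm_sq_tsum_le hD hu))

theorem IsBoundedForm.norm_tsum_le (hA : IsBoundedForm A D) (hD : 0 ≤ D) {u : ι → ℂ}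
    (hu : Memℓp u 2) :
    ‖(⟨_, hA.memℓp_tsum hD hu⟩ : lp (fun _ : ι => ℂ) 2)‖ ≤
      D * ‖(⟨u, hu⟩ : lp (fun _ : ι => ℂ) 2)‖ := by
  rw [norm_ellTwo_eq, norm_ellTwo_eq]
  exact Real.sqrt_le_iff.mpr ⟨by positivity,
    Real.tsum_le_of_sum_le (fun _ => sq_nonneg _) (hA.sum_norm_sq_tsum_le hD hu)⟩

/-- The bounded operator on `ℓ²` given by a matrix with bounded bilinear form. -/
noncomputable def IsBoundedForm.toCLM (hA : IsBoundedForm A D) (hD : 0 ≤ D) :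
    lp (fun _ : ι => ℂ) 2 →L[ℂ] lp (fun _ : ι => ℂ) 2 :=
  LinearMap.mkContinuous
    { toFun := fun u => ⟨_, hA.memℓp_tsum hD u.2⟩
      map_add' := fun u w => by
        ext m
        simp only [lp.coeFn_add, Pi.add_apply, mul_add]
        exact (hA.summable_row_mul u.2 m).tsum_add (hA.summable_row_mul w.2 m)
      map_smul' := fun c u => by
        ext m
        simp only [lp.coeFn_smul, Pi.smul_apply, smul_eq_mul, RingHom.id_apply, mul_left_comm]
        exact tsum_mul_left } D fun u => hA.norm_tsum_le hD u.2

theorem IsBoundedForm.toCLM_apply (hA : IsBoundedForm A D) (hD : 0 ≤ D)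
    (u : lp (fun _ : ι => ℂ) 2) : (hA.toCLM hD u : ι → ℂ) = fun m => ∑' n, A m n * u n := rfl

theorem IsBoundedForm.norm_toCLM_le (hA : IsBoundedForm A D) (hD : 0 ≤ D) :
    ‖hA.toCLM hD‖ ≤ D :=
  LinearMap.mkContinuous_norm_le _ hD _

theorem IsBoundedForm.of_equiv {κ : Type*} (e : κ ≃ ι)
    (hA : IsBoundedForm (fun m n => A (e m) (e n)) D) : IsBoundedForm A D := by
  intro S T u v
  have h := hA (S.map e.symm.toEmbedding) (T.map e.symm.toEmbedding) (u ∘ e) (v ∘ e)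
  simpa only [Finset.sum_map, Function.comp_apply, Equiv.coe_toEmbedding,
    Equiv.apply_symm_apply] using h

theorem IsBoundedForm.mono (hA : IsBoundedForm A D) {D' : ℝ} (h : D ≤ D') :
    IsBoundedForm A D' := fun S T u v => (hA S T u v).trans (by gcongr)

theorem IsBoundedForm.const_mul (hA : IsBoundedForm A D) (c : ℂ) :
    IsBoundedForm (fun m n => c * A m n) (‖c‖ * D) := by
  intro S T u v
  have heq : ∑ m ∈ S, ∑ n ∈ T, v m * u n * (c * A m n) =
      c * ∑ m ∈ S, ∑ n ∈ T, v m * u n * A m n := by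
    simp only [Finset.mul_sum]
    exact Finset.sum_congr rfl fun m _ => Finset.sum_congr rfl fun n _ => by ring
  rw [heq, norm_mul, mul_assoc, mul_assoc]
  refine mul_le_mul_of_nonneg_left ?_ (norm_nonneg c)
  rw [← mul_assoc]
  exact hA S T u v

end Matrix

/-! ### The scaled lattice, rapidly decreasing functions and the operator kernel. -/

section Lattice

variable {d : ℕ} {ε : ℝ}

/-- The lattice point `εn`. -/
noncomputable def latticeEquiv (d : ℕ) {ε : ℝ} (hε : ε ≠ 0) :
    (Fin d → ℤ) ≃ scaledLattice d ε :=
  Equiv.ofInjective (fun (n : Fin d → ℤ) (i : Fin d) => ε * (n i : ℝ)) fun m n h => by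
    ext i
    have := congrFun h i
    simpa [hε] using this

theorem latticeEquiv_coe (hε : ε ≠ 0) (n : Fin d → ℤ) :
    (latticeEquiv d hε n : Fin d → ℝ) = fun i => ε * (n i : ℝ) := rfl

/-- Rapidly decreasing functions are bounded by `C ∏ (1 + x_i²)⁻¹`. -/
theorem IsRapidlyDecreasing.exists_bound {u : scaledLattice d ε → ℂ} (hu : IsRapidlyDecreasing u) :
    ∃ C : ℝ, 0 ≤ C ∧ ∀ x : scaledLattice d ε, (∏ i, (1 + (x : Fin d → ℝ) i ^ 2)) * ‖u x‖ ≤ C := by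
  choose B hB using hu
  have hB' : ∀ α (x : scaledLattice d ε), |∏ i, (x : Fin d → ℝ) i ^ α i| * ‖u x‖ ≤ B α := by
    intro α x
    have h := hB α ⟨x, rfl⟩
    dsimp only at h
    rwa [norm_mul, Complex.norm_real, Real.norm_eq_abs] at h
  have key : ∀ x : scaledLattice d ε, (∏ i, (1 + (x : Fin d → ℝ) i ^ 2)) * ‖u x‖ ≤
      ∑ α ∈ cubeIndices d, |B fun i => 2 * α i| := by
    intro x
    have h := Finset.prod_univ_sum (fun _ : Fin d => Finset.range 2)
      fun i j => (x : Fin d → ℝ) i ^ (2 * j)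
    -- Expanding `∏ (1 + x_i²)` gives exactly the monomials with exponents `0` or `2`.
    simp only [Finset.sum_range_succ, Finset.range_zero, Finset.sum_empty, zero_add, mul_zero,
      pow_zero, mul_one] at h
    rw [h, Finset.sum_mul]
    refine Finset.sum_le_sum fun α _ => ?_
    refine (mul_le_mul_of_nonneg_right (le_abs_self _) (norm_nonneg _)).trans ?_
    exact (hB' (fun i => 2 * α i) x).trans (le_abs_self _)
  exact ⟨_, Finset.sum_nonneg fun _ _ => abs_nonneg _, key⟩

theorem IsRapidlyDecreasing.memℓp_two (hε : 0 < ε) {u : scaledLattice d ε → ℂ}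
    (hu : IsRapidlyDecreasing u) : Memℓp u 2 := by
  obtain ⟨C, hC0, hC⟩ := hu.exists_bound
  rw [memℓp_two_iff, ← (latticeEquiv d hε.ne').summable_iff]
  -- With `N = ⌈ε⁻¹⌉` one has `1/N ≤ ε`, so `(1 + (ε n_i)²)⁻¹ ≤ (1 + (n_i/N)²)⁻¹` and the earlier
  -- weight sum applies.
  have hN : ⌈ε⁻¹⌉₊ ≠ 0 := (Nat.ceil_pos.mpr (inv_pos.mpr hε)).ne'
  refine summable_of_sum_le (c := C ^ 2 * (6 * (⌈ε⁻¹⌉₊ : ℝ)) ^ d) (fun _ => sq_nonneg _) fun P => ?_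
  refine le_trans ?_ (mul_le_mul_of_nonneg_left (sum_prod_inv_one_add_sq_le hN
    (P.map (Equiv.neg _).toEmbedding) 0) (sq_nonneg C))
  rw [Finset.sum_map, Finset.mul_sum]
  refine Finset.sum_le_sum fun n _ => ?_
  have hn := hC (latticeEquiv d hε.ne' n)
  rw [latticeEquiv_coe] at hn
  set a := ‖u (latticeEquiv d hε.ne' n)‖
  set w : ℝ := ∏ i, (1 + (ε * (n i : ℝ)) ^ 2) with hw
  have hw1 : 1 ≤ w := by
    calc (1 : ℝ) = ∏ _i : Fin d, 1 := by simp
      _ ≤ w := Finset.prod_le_prod (fun _ _ => zero_le_one) fun i _ => by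
          linarith [sq_nonneg (ε * (n i : ℝ))]
  have hw0 : 0 < w := by linarith
  have ha : a ≤ C / w := (le_div_iff₀ hw0).mpr (by rwa [mul_comm])
  have h1 : a ^ 2 ≤ C ^ 2 * w⁻¹ := by
    calc a ^ 2 ≤ (C / w) ^ 2 := pow_le_pow_left₀ (norm_nonneg _) ha 2
      _ = C ^ 2 * (w⁻¹ * w⁻¹) := by ring
      _ ≤ C ^ 2 * (w⁻¹ * 1) := by
          gcongr
          exact inv_le_one_of_one_le₀ hw1
      _ = C ^ 2 * w⁻¹ := by rw [mul_one]
  refine h1.trans (mul_le_mul_of_nonneg_left ?_ (sq_nonneg C))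
  rw [hw, ← Finset.prod_inv_distrib]
  refine Finset.prod_le_prod (fun _ _ => by positivity) fun i _ => ?_
  have hce : ((⌈ε⁻¹⌉₊ : ℕ) : ℝ)⁻¹ ≤ ε := inv_le_of_inv_le₀ hε (Nat.le_ceil _)
  simp only [Equiv.coe_toEmbedding, Equiv.neg_apply, zero_sub, neg_neg]
  rw [mul_pow, div_pow, div_eq_inv_mul, ← inv_pow]
  gcongr

/-- The matrix of the lattice pseudo-differential operator. -/
noncomputable def latticeKernel (a : (Fin d → ℝ) → (Fin d → ℝ) → ℝ → ℂ) (ε : ℝ)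
    (x y : scaledLattice d ε) : ℂ :=
  ((2 * (Real.pi : ℂ)) ^ d)⁻¹ * ∫ ξ in torusBox d,
    Complex.exp (Complex.I / (ε : ℂ) *
      ((∑ i, ((y : Fin d → ℝ) i - (x : Fin d → ℝ) i) * ξ i : ℝ) : ℂ)) * a x ξ ε

theorem opTerm_eq (a : (Fin d → ℝ) → (Fin d → ℝ) → ℝ → ℂ) (u : scaledLattice d ε → ℂ)
    (x y : scaledLattice d ε) :
    opTerm a ε u x y = (2 * (Real.pi : ℂ)) ^ d * (latticeKernel a ε x y * u y) := by
  have h : (2 * (Real.pi : ℂ)) ^ d ≠ 0 :=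
    pow_ne_zero d (mul_ne_zero two_ne_zero (Complex.ofReal_ne_zero.mpr Real.pi_ne_zero))
  rw [opTerm, integral_mul_const, latticeKernel, mul_assoc, mul_inv_cancel_left₀ h]
  rfl

theorem latticeOp_eq (a : (Fin d → ℝ) → (Fin d → ℝ) → ℝ → ℂ) (u : scaledLattice d ε → ℂ) :
    latticeOp a ε u = fun x => ∑' y, latticeKernel a ε x y * u y := by
  have h : (2 * (Real.pi : ℂ)) ^ d ≠ 0 :=
    pow_ne_zero d (mul_ne_zero two_ne_zero (Complex.ofReal_ne_zero.mpr Real.pi_ne_zero))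
  ext x
  simp only [latticeOp, opTerm_eq, tsum_mul_left]
  rw [inv_mul_cancel_left₀ h]

theorem latticeKernel_latticeEquiv (a : (Fin d → ℝ) → (Fin d → ℝ) → ℝ → ℂ) (hε : ε ≠ 0)
    (m n : Fin d → ℤ) :
    latticeKernel a ε (latticeEquiv d hε m) (latticeEquiv d hε n) =
      ((2 * (Real.pi : ℂ)) ^ d)⁻¹ * ∫ ξ in torusBox d,
        torusChar (n - m) ξ * a (fun i => ε * (m i : ℝ)) ξ ε := by
  rw [latticeKernel]
  congr 2
  ext ξ
  simp only [latticeEquiv_coe, torusChar]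
  congr 2
  have hε' : (ε : ℂ) ≠ 0 := Complex.ofReal_ne_zero.mpr hε
  push_cast
  rw [Finset.mul_sum, Finset.mul_sum]
  refine Finset.sum_congr rfl fun i _ => ?_
  simp only [Pi.sub_apply]
  push_cast
  field_simp

end Lattice

/-! ### Symbol estimates at the scale `N = ⌈ε^{-1/2}⌉`. -/

section Symbol

variable {d : ℕ} {r δ : ℝ} {a : (Fin d → ℝ) → (Fin d → ℝ) → ℝ → ℂ}

theorem symbolSeminorm_nonneg (m : (Fin d → ℝ) → (Fin d → ℝ) → ℝ) (α β : Fin d → ℕ) :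
    0 ≤ symbolSeminorm r δ m a α β :=
  Real.sInf_nonneg fun _ h => h.1

/-- The infimum defining the seminorm is attained. -/
theorem IsSymbol.symbolBound_symbolSeminorm (ha : IsSymbol r δ (fun _ _ => 1) a)
    (α β : Fin d → ℕ) :
    SymbolBound r δ (fun _ _ => 1) a α β (symbolSeminorm r δ (fun _ _ => 1) a α β) := by
  intro ε hε hε1 x ξ
  obtain ⟨C, hC0, hC⟩ := ha.bound α β
  have hpos : 0 < ε ^ (r - δ * (((∑ i, α i) + ∑ i, β i : ℕ) : ℝ)) := Real.rpow_pos_of_pos hε _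
  -- For a fixed point the estimate says that a fixed number is at most `C`, a condition that passes
  -- to the infimum.
  rw [mul_one, ← div_le_iff₀ hpos]
  refine le_csInf ⟨C, hC0.le, hC⟩ fun C' hC' => ?_
  rw [div_le_iff₀ hpos]
  simpa using hC'.2 ε hε hε1 x ξ

theorem IsSymbol.isTorusSmooth {m : (Fin d → ℝ) → (Fin d → ℝ) → ℝ} (ha : IsSymbol r δ m a)
    {ε : ℝ} (hε : 0 < ε) (hε1 : ε ≤ 1) : IsTorusSmooth fun p => a p.1 p.2 ε where
  contDiff := ha.smooth ε hε hε1
  periodic x ξ n := ha.periodic ε hε hε1 x ξ n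

/-- With `E = ε^{-1/2}`, `s` differences and `t` frequency derivatives of a symbol cost at most `ε^r
E^{t-s}`; rounding `E` up to the integer `N ≤ 2E` costs `2^s ≤ 2^d`. -/
theorem pow_mul_rpow_le {ε : ℝ} (hε : 0 < ε) (hε1 : ε ≤ 1) (hδ : δ ≤ 1 / 2) {s t : ℕ}
    (hs : s ≤ d) :
    ε ^ s * ε ^ (r - δ * ((s + t : ℕ) : ℝ)) ≤
      2 ^ d * ε ^ r * (((⌈ε ^ (-(1 / 2) : ℝ)⌉₊ : ℕ) : ℝ) ^ t /
        ((⌈ε ^ (-(1 / 2) : ℝ)⌉₊ : ℕ) : ℝ) ^ s) := by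
  set E : ℝ := ε ^ (-(1 / 2) : ℝ) with hE
  set N : ℝ := ((⌈E⌉₊ : ℕ) : ℝ)
  have hE0 : 0 < E := Real.rpow_pos_of_pos hε _
  have hE1 : 1 ≤ E := Real.one_le_rpow_of_pos_of_le_one_of_nonpos hε hε1 (by norm_num)
  have hEN : E ≤ N := Nat.le_ceil E
  have hN0 : 0 < N := hE0.trans_le hEN
  have hN2 : N ≤ 2 * E := by linarith [Nat.ceil_lt_add_one hE0.le]
  have hεE : ε * (E * E) = 1 := by
    rw [hE, ← Real.rpow_add hε]
    norm_num
    rw [Real.rpow_neg_one, mul_inv_cancel₀ hε.ne']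
  have hst : ε ^ (r - δ * ((s + t : ℕ) : ℝ)) ≤ ε ^ r * E ^ (s + t) := by
    rw [hE, ← Real.rpow_mul_natCast hε.le, ← Real.rpow_add hε]
    refine Real.rpow_le_rpow_of_exponent_ge hε hε1 ?_
    have : δ * ((s + t : ℕ) : ℝ) ≤ 1 / 2 * ((s + t : ℕ) : ℝ) :=
      mul_le_mul_of_nonneg_right hδ (Nat.cast_nonneg _)
    linarith
  have hr : 0 < ε ^ r := Real.rpow_pos_of_pos hε r
  calc ε ^ s * ε ^ (r - δ * ((s + t : ℕ) : ℝ)) ≤ ε ^ s * (ε ^ r * E ^ (s + t)) := by gcongr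
    _ = ε ^ r * ((ε * (E * E)) ^ s * (E ^ t / E ^ s)) := by
        field_simp
        ring
    _ = ε ^ r * (E ^ t / E ^ s) := by rw [hεE, one_pow, one_mul]
    _ = ε ^ r * (2 ^ s * E ^ t / (2 * E) ^ s) := by
        rw [mul_pow, mul_div_mul_left _ _ (by positivity)]
    _ ≤ ε ^ r * (2 ^ d * N ^ t / N ^ s) := by
        gcongr
        norm_num
    _ = _ := by ring

/-- The matrix of a lattice pseudo-differential operator with symbol in `S^r_δ(1)`, `δ ≤ 1/2`, has
bilinear form bounded by finitely many seminorms. -/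
theorem IsSymbol.isBoundedForm_latticeKernel (hδ : δ ≤ 1 / 2)
    (ha : IsSymbol r δ (fun _ _ => 1) a) {ε : ℝ} (hε : 0 < ε) (hε1 : ε ≤ 1) :
    IsBoundedForm (latticeKernel a ε) (24 ^ d * (∑ p ∈ cubeIndices d ×ˢ cubeIndices d,
      symbolSeminorm r δ (fun _ _ => 1) a p.1 p.2) * ε ^ r) := by
  have hF := ha.isTorusSmooth hε hε1
  have hN : ⌈ε ^ (-(1 / 2) : ℝ)⌉₊ ≠ 0 := (Nat.ceil_pos.mpr (Real.rpow_pos_of_pos hε _)).ne'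
  have hr : 0 < ε ^ r := Real.rpow_pos_of_pos hε r
  have hbd := norm_bilinear_le hF hN ε
    (C := fun σ τ => 2 ^ d * ε ^ r * symbolSeminorm r δ (fun _ _ => 1) a σ τ)
    (fun σ τ => by
      have := symbolSeminorm_nonneg (r := r) (δ := δ) (a := a) (fun _ _ => 1) σ τ
      positivity)
    (fun σ hσ τ _ p => by
      have hsn := symbolSeminorm_nonneg (r := r) (δ := δ) (a := a) (fun _ _ => 1) σ τ
      have hs : ∑ i, σ i ≤ d := by
        refine (Finset.sum_le_sum fun i _ => le_one_of_mem_cubeIndices hσ i).trans ?_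
        simp
      refine (hF.norm_latticeDiff_freqDeriv_le hε.le σ τ
        (fun p => ha.symbolBound_symbolSeminorm σ τ ε hε hε1 p.1 p.2) p).trans ?_
      rw [mul_one, mul_left_comm]
      refine (mul_le_mul_of_nonneg_left
        (pow_mul_rpow_le hε hε1 hδ (d := d) (r := r) hs) hsn).trans (le_of_eq ?_)
      ring)
  refine IsBoundedForm.of_equiv (latticeEquiv d hε.ne') ?_
  simp only [latticeKernel_latticeEquiv]
  refine (IsBoundedForm.const_mul (A := fun m n => ∫ ξ in torusBox d,
    torusChar (n - m) ξ * a (fun i => ε * (m i : ℝ)) ξ ε) (fun S T u v => hbd S T u v) _).mono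
    (le_of_eq ?_)
  have hpi : ‖((2 * (Real.pi : ℂ)) ^ d)⁻¹‖ = ((2 * Real.pi) ^ d)⁻¹ := by
    rw [norm_inv, norm_pow, norm_mul, Complex.norm_real, Real.norm_of_nonneg Real.pi_pos.le]
    norm_num
  rw [hpi, Finset.sum_product, show (24 : ℝ) = 12 * 2 by norm_num, mul_pow 12 2]
  simp only [← Finset.mul_sum]
  have : (2 * Real.pi) ^ d ≠ 0 := by positivity
  field_simp

end Symbol

end LatticePsdo

theorem propositionA5 (d : ℕ) :
    ∃ (F : Finset ((Fin d → ℕ) × (Fin d → ℕ))) (K : ℝ), 0 < K ∧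
      ∀ (r δ : ℝ), 0 ≤ δ → δ ≤ 1 / 2 →
      ∀ a : (Fin d → ℝ) → (Fin d → ℝ) → ℝ → ℂ, IsSymbol r δ (fun _ _ => 1) a →
      ∀ M : ℝ, 0 < M → K * ∑ p ∈ F, symbolSeminorm r δ (fun _ _ => 1) a p.1 p.2 ≤ M →
      ∀ ε : ℝ, 0 < ε → ε ≤ 1 →
        (∀ u : scaledLattice d ε → ℂ, IsRapidlyDecreasing u →
          (∀ x : scaledLattice d ε, Summable (opTerm a ε u x)) ∧
          ∃ (hu : Memℓp u 2) (hv : Memℓp (latticeOp a ε u) 2),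
            ‖(⟨latticeOp a ε u, hv⟩ : ellTwo d ε)‖ ≤ M * ε ^ r * ‖(⟨u, hu⟩ : ellTwo d ε)‖) ∧
        ∃ T : ellTwo d ε →L[ℂ] ellTwo d ε,
          (∀ u : ellTwo d ε, IsRapidlyDecreasing (u : scaledLattice d ε → ℂ) →
            (T u : scaledLattice d ε → ℂ) = latticeOp a ε (u : scaledLattice d ε → ℂ)) ∧
          ‖T‖ ≤ M * ε ^ r := by
  -- `24^d` is `12^d` from the bilinear estimate times `2^d` from rounding `ε^{-1/2}` to an integer;
  -- the factors `(2π)^d` cancel.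
  refine ⟨cubeIndices d ×ˢ cubeIndices d, 24 ^ d, by positivity, ?_⟩
  intro r δ _ hδ a ha M hM hKM ε hε hε1
  have hr : 0 < ε ^ r := Real.rpow_pos_of_pos hε r
  have hD : 0 ≤ M * ε ^ r := by positivity
  have hA : IsBoundedForm (latticeKernel a ε) (M * ε ^ r) :=
    (ha.isBoundedForm_latticeKernel hδ hε hε1).mono (mul_le_mul_of_nonneg_right hKM hr.le)
  refine ⟨fun u hu => ⟨fun x => ?_, hu.memℓp_two hε, ?_, ?_⟩, hA.toCLM hD, fun u _ => ?_,
    hA.norm_toCLM_le hD⟩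
  · rw [funext (opTerm_eq a u x)]
    exact (hA.summable_row_mul (hu.memℓp_two hε) x).mul_left _
  · rw [latticeOp_eq]
    exact hA.memℓp_tsum hD (hu.memℓp_two hε)
  · simp only [latticeOp_eq]
    exact hA.norm_tsum_le hD (hu.memℓp_two hε)
  · rw [hA.toCLM_apply, latticeOp_eq]
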